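/- Let $d\ge 2$ be an integer, $\lambda=\frac{d-2}{2}$, $e_0(x)=1$ on $[-1,1]$, and $$[f,g]_\lambda=\int_{-1}^1 f(x)g(x)(1-x^2)^{\lambda-\frac12}\,dx,\qquad T_\lambda f(x)=-\int_{-1}^x(1-y^2)^{-\lambda-\frac12}\int_{-1}^y(1-z^2)^{\lambda-\frac12}f(z)\,dz\,dy .$$ Let $W_n^\lambda(x)={}_2F_1\!\left(-n,n+2\lambda;\lambda+\tfrac12;\tfrac{1-x}{2}\right)$ be the Gegenbauer polynomial of degree $n$ and order $\lambda$ normalized by $W_n^\lambda(1)=1$, and let $N_{d,n}=\binom{n+d-1}{n}-\binom{n+d-3}{n-2}$ (the second binomial coefficient being $0$ for $n<2$). For an integer $m\ge1$ put $D_{d,m}=[-1,1]$ if $2m\ge d$ and $D_{d,m}=[-1,1)$ if $2m<d$. The thinplate spline function $$k_{d,m}\sim\sum_{n=1}^\infty [n(n+d-2)]^{-m}N_{d,n}W_n^\lambda$$ is defined by this series read as an orthogonal expansion: it is the continuous function $k$ on $D_{d,m}$ that is integrable against $(1-x^2)^{\lambda-\frac12}$ on $(-1,1)$ and satisfies $[k,e_0]_\lambda=0$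 and $[k,W_n^\lambda]_\lambda=[n(n+d-2)]^{-m}N_{d,n}[W_n^\lambda,W_n^\lambda]_\lambda$ for $n\ge1$. Then for every $m\ge 1$ the function $k_{d,m}$ exists and is unique, and a sequence of functions coincides with $(k_{d,m})_{m\ge1}$ (the $m$-th on $D_{d,m}$) if and only if it is generated by the recurrence $$k_{d,m}(x)=\begin{cases}\dfrac{[e_0,T_\lambda e_0]_\lambda}{[e_0,e_0]_\lambda}-(T_\lambda e_0)(x),& m=1,\\[2ex](T_\lambda k_{d,m-1})(x)-\dfrac{[e_0,T_\lambda k_{d,m-1}]_\lambda}{[e_0,e_0]_\lambda},& m>1,\end{cases}\qquad x\in D_{d,m}.$$ All the integrals in the recurrence exist, and $[e_0,e_0]_\lambda>0$. At every $x\in[-1,1]$ at which the series converges, its sum is $k_{d,m}(x)$; if $2m\ge d$ it converges absolutely at every $x\in[-1,1]$. If $2m<d$, then at the remaining point $x=1$ both sides of the recurrence are $+\infty$: the partial sums of the series at $1$ tend to $+\infty$, and as $x\to1^-$ so do $k_{d,m}(x)$ and, respectively, $-(T_\lambda e_0)(x)$ (for $m=1$) or $(T_\lambda k_{d,m-1})(x)$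 (for $m>1$). -/

import Mathlib

open Set Filter Topology MeasureTheory

noncomputable section

namespace Thinplate

/-- The Gegenbauer order `λ = (d - 2) / 2` attached to the sphere `S^{d-1} ⊆ ℝ^d`. -/
def lam (d : ℕ) : ℝ := ((d : ℝ) - 2) / 2

/-- The weight `(1 - x²)^{λ - 1/2}`. -/
def weight (d : ℕ) (x : ℝ) : ℝ := (1 - x ^ 2) ^ (lam d - 1 / 2)

/-- The bracket `[f, g]_λ = ∫_{-1}^1 f(x) g(x) (1 - x²)^{λ - 1/2} dx`. -/
def bracket (d : ℕ) (f g : ℝ → ℝ) : ℝ :=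
  ∫ x in (-1 : ℝ)..1, f x * g x * weight d x

/-- The integrand of the outer integral of `T_λ f`:
`(1 - y²)^{-λ - 1/2} ∫_{-1}^y (1 - z²)^{λ - 1/2} f(z) dz`. -/
def outerIntegrand (d : ℕ) (f : ℝ → ℝ) (y : ℝ) : ℝ :=
  (1 - y ^ 2) ^ (-lam d - 1 / 2) * ∫ z in (-1 : ℝ)..y, weight d z * f z

/-- The operator
`T_λ f(x) = -∫_{-1}^x (1 - y²)^{-λ - 1/2} ∫_{-1}^y (1 - z²)^{λ - 1/2} f(z) dz dy`. -/
def opT (d : ℕ) (f : ℝ → ℝ) (x : ℝ) : ℝ :=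
  -∫ y in (-1 : ℝ)..x, outerIntegrand d f y

/-- The constant function `e₀ = 1`. -/
def e0 : ℝ → ℝ := fun _ => 1

/-- `N_{d,n} = binom (n+d-1) n - binom (n+d-3) (n-2)`, the dimension of the space of spherical
harmonics of degree `n` on `S^{d-1}`; the second binomial coefficient is `0` for `n < 2`. -/
def harmDim (d n : ℕ) : ℝ :=
  ((n + d - 1).choose n : ℝ) - if 2 ≤ n then ((n + d - 3).choose (n - 2) : ℝ) else 0

/-- The Gegenbauer polynomial `W_n^λ` of degree `n` and order `λ = (d - 2) / 2`, normalized by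
`W_n^λ(1) = 1`. The Gegenbauer polynomial `C_n^λ` is a constant multiple of the hypergeometric
polynomial `₂F₁(-n, n + 2λ; λ + 1/2; (1 - x)/2)`, whose value at `x = 1` is `1`. In this form the
case `λ = 0` (Chebyshev polynomials) is included. -/
def gegW (d n : ℕ) (x : ℝ) : ℝ :=
  ordinaryHypergeometric (-(n : ℝ)) ((n : ℝ) + 2 * lam d) (lam d + 1 / 2) ((1 - x) / 2)

/-- The coefficient of `W_n^λ` in the series for `k_{d,m}`: it is `[n(n+d-2)]^{-m} N_{d,n}` for
`n ≥ 1`, and there is no term with `n = 0`. -/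
def coeff (d m n : ℕ) : ℝ :=
  if n = 0 then 0 else (((n : ℝ) * ((n : ℝ) + (d : ℝ) - 2)) ^ m)⁻¹ * harmDim d n

/-- The term of index `n` of the series for `k_{d,m}(x)`. -/
def term (d m : ℕ) (x : ℝ) (n : ℕ) : ℝ := coeff d m n * gegW d n x

/-- The part of `[-1, 1]` on which `k_{d,m}` is finite: the point `1` is left out exactly when
`2m < d`, where the series at `1` (whose terms are positive) diverges to `+∞`. -/
def dom (d m : ℕ) : Set ℝ := if d ≤ 2 * m then Icc (-1) 1 else Ico (-1) 1

/-- `k` is the function `k_{d,m}` defined by the series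
`∑_{n ≥ 1} [n(n+d-2)]^{-m} N_{d,n} W_n^λ`, read as an orthogonal (Fourier-Gegenbauer) expansion:
`k` is continuous, integrable against the weight, and its `n`-th Fourier-Gegenbauer coefficient
`[k, W_n^λ]_λ / [W_n^λ, W_n^λ]_λ` is the `n`-th coefficient of the series. -/
structure IsSplineFunction (d m : ℕ) (k : ℝ → ℝ) : Prop where
  continuousOn : ContinuousOn k (dom d m)
  integrable : IntervalIntegrable (fun x => k x * weight d x) volume (-1) 1
  expansion : ∀ n : ℕ,
    bracket d k (gegW d n) = coeff d m n * bracket d (gegW d n) (gegW d n)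

/-- All the integrals in `T_λ f(x)`, for `x` in `dom d m`, and in `[e₀, T_λ f]_λ` exist. -/
def StepDefined (d m : ℕ) (f : ℝ → ℝ) : Prop :=
  IntervalIntegrable (fun z => weight d z * f z) volume (-1) 1 ∧
  (∀ x ∈ dom d m, IntervalIntegrable (outerIntegrand d f) volume (-1) x) ∧
  IntervalIntegrable (fun x => e0 x * opT d f x * weight d x) volume (-1) 1

end Thinplate

end

/-!
Write `B = [e₀, e₀]_λ` and let `S f = T_λ f - [e₀, T_λ f]_λ / B` be one step of the recurrence
(`centeredT`). The operator `T_λ` inverts the Gegenbauer operator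
`q ↦ (d - 1) x q' - (1 - x²) q''` up to a constant, and `W_n^λ` is an eigenfunction of the latter
with eigenvalue `n (n + d - 2)`. Formally, therefore, `S` divides the `n`-th coefficient of an
expansion without constant term by `n (n + d - 2)`. The first step fits the same pattern: the
recurrence for `m = 1` is `S` applied to the constant `-1`, and `-1` plays the role of
`∑_{n ≥ 1} N_{d,n} W_n^λ`, because this series together with its missing term `n = 0` represents
a multiple of the point mass at `x = 1`, which `T_λ` does not see on `[-1, 1)`.

All this is made precise by Abel means. The Abel mean `∑_n N_{d,n} r^n W_n^λ` is the Poisson kernel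
`(1 - r²) / (1 - 2rx + r²)^{d/2}` (`tsum_harmDim_mul_gegW`). It is nonnegative, has constant mass,
and tends to `0` away from `x = 1` as `r → 1`. Each Abel mean is an absolutely convergent series
since `|W_n^λ| ≤ 1` (`abs_gegPoly_le`), so there the formal computation is a theorem
(`centeredT_abelSum`). Dominated convergence then passes to the limit, at the level of `T_λ` with
the majorant `(1 - x)^{-λ}`, which `T_λ` reproduces (`tendsto_abelSum`). The outcome is that the
Abel means of the spline series converge on `[-1, 1)` to the functions generated by the recurrence
(`spline`). Their expansion coefficients follow (`bracket_spline_gegW`), and so does, by Abel's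
theorem, the value of the series wherever it converges (`spline_eq_of_tendsto`). Uniqueness is the
completeness of the polynomials `W_n^λ` (`eqOn_zero_of_bracket_eq_zero`).

For the behaviour at `x = 1`, the primitive of `(1 - z²)^{λ - 1/2}` times an increasing function of
weighted mean zero is nonpositive, so the functions generated by the recurrence are increasing and
the integrands in `T_λ` have constant sign (`outerIntegrand_spline_nonpos`). If `2m ≥ d`, the
coefficients are summable, the functions are bounded and the integrals converge up to `x = 1`. If
`2m < d`, averaging an upper bound of the function against the Poisson kernel bounds the partial
sums of the coefficients (`sum_coeff_le_of_spline_le`), which contradicts their divergence; hence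
the increasing function tends to `+∞`. The averaging needs the norms
`N_{d,n} [W_n^λ, W_n^λ]_λ = B` (`harmDim_mul_bracket_gegW`).
-/

namespace Thinplate

open Polynomial

/-! ### Gegenbauer polynomials and their differential equation -/

/-- The `k`-th coefficient of the hypergeometric polynomial `₂F₁(-n, n + 2λ; λ + 1/2; t)`. -/
noncomputable def hypCoeff (d n k : ℕ) : ℝ :=
  ordinaryHypergeometricCoefficient (-(n : ℝ)) ((n : ℝ) + 2 * lam d) (lam d + 1 / 2) k

/-- The hypergeometric polynomial `₂F₁(-n, n + 2λ; λ + 1/2; t)` in the variable `t`. -/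
noncomputable def hypPoly (d n : ℕ) : ℝ[X] :=
  ∑ k ∈ Finset.range (n + 1), C (hypCoeff d n k) * X ^ k

/-- The Gegenbauer polynomial `W_n^λ` as an element of `ℝ[X]`. -/
noncomputable def gegPoly (d n : ℕ) : ℝ[X] :=
  (hypPoly d n).comp (C (1 / 2) * (1 - X))

/-- The Gegenbauer eigenvalue `n (n + d - 2)`. -/
def eig (d n : ℕ) : ℝ := (n : ℝ) * ((n : ℝ) + (d : ℝ) - 2)

/-- The Gegenbauer operator `q ↦ (d - 1) x q' - (1 - x²) q''`; it is the zonal part of minus the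
Laplace-Beltrami operator of the sphere. -/
noncomputable def gegL (d : ℕ) (q : ℝ[X]) : ℝ[X] :=
  C ((d : ℝ) - 1) * (X * derivative q) - (1 - X ^ 2) * derivative (derivative q)

lemma two_le_cast {d : ℕ} (hd : 2 ≤ d) : (2 : ℝ) ≤ d := by exact_mod_cast hd

lemma lam_nonneg {d : ℕ} (hd : 2 ≤ d) : 0 ≤ lam d := by
  have := two_le_cast hd
  unfold lam; linarith

lemma hypCoeff_zero (d n : ℕ) : hypCoeff d n 0 = 1 := by
  simp [hypCoeff, ordinaryHypergeometricCoefficient]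

lemma hypCoeff_succ {d : ℕ} (hd : 2 ≤ d) (n k : ℕ) :
    ((k : ℝ) + 1) * (k + (lam d + 1 / 2)) * hypCoeff d n (k + 1) =
      ((k : ℝ) - n) * (k + n + 2 * lam d) * hypCoeff d n k := by
  have hl := lam_nonneg hd
  have h1 : (k : ℝ) + (lam d + 1 / 2) ≠ 0 := by positivity
  have h2 : (ascPochhammer ℝ k).eval (lam d + 1 / 2) ≠ 0 :=
    (ascPochhammer_pos k _ (by positivity)).ne'
  have h3 : (k.factorial : ℝ) ≠ 0 := by positivity
  unfold hypCoeff ordinaryHypergeometricCoefficient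
  rw [ascPochhammer_succ_eval, ascPochhammer_succ_eval, ascPochhammer_succ_eval,
    Nat.factorial_succ]
  push_cast
  have h4 : lam d + 1 / 2 + (k : ℝ) ≠ 0 := by positivity
  field_simp
  ring

lemma hypCoeff_eq_zero (d n k : ℕ) (h : n < k) : hypCoeff d n k = 0 := by
  simp [hypCoeff, ordinaryHypergeometricCoefficient, ascPochhammer_eval_neg_coe_nat_of_lt h]

lemma hypCoeff_ne_zero {d : ℕ} (hd : 2 ≤ d) (n k : ℕ) (h : k ≤ n) : hypCoeff d n k ≠ 0 := by
  induction k with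
  | zero => simp [hypCoeff_zero]
  | succ k ih =>
    have hl := lam_nonneg hd
    intro h0
    have := hypCoeff_succ hd n k
    rw [h0, mul_zero] at this
    have h1 : (k : ℝ) + 1 ≤ n := by exact_mod_cast h
    have hk : (0 : ℝ) ≤ k := by positivity
    rcases mul_eq_zero.1 this.symm with h2 | h2
    · rcases mul_eq_zero.1 h2 with h3 | h3
      · linarith
      · linarith
    · exact ih (by omega) h2

lemma hypPoly_coeff (d n k : ℕ) : (hypPoly d n).coeff k = hypCoeff d n k := by
  simp only [hypPoly, finsetSum_coeff, coeff_C_mul, coeff_X_pow, mul_ite, mul_one, mul_zero]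
  rw [Finset.sum_ite_eq]
  split_ifs with h
  · rfl
  · rw [hypCoeff_eq_zero]
    simpa using h

lemma gegW_eq_sum (d n : ℕ) (x : ℝ) :
    gegW d n x = ∑ k ∈ Finset.range (n + 1), hypCoeff d n k * ((1 - x) / 2) ^ k := by
  unfold gegW
  rw [ordinaryHypergeometric_eq_tsum]
  simp only [smul_eq_mul]
  rw [tsum_eq_sum (s := Finset.range (n + 1))]
  · rfl
  · intro k hk
    have := hypCoeff_eq_zero d n k (by simpa using hk)
    rw [hypCoeff, ordinaryHypergeometricCoefficient] at this
    rw [this, zero_mul]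

lemma gegW_eq_eval (d n : ℕ) (x : ℝ) : gegW d n x = (gegPoly d n).eval x := by
  rw [gegW_eq_sum, gegPoly, eval_comp, hypPoly, eval_finsetSum]
  refine Finset.sum_congr rfl fun k _ => ?_
  simp
  left; ring

lemma gegPoly_eval_one (d n : ℕ) : (gegPoly d n).eval 1 = 1 := by
  rw [← gegW_eq_eval]
  simp [gegW]

lemma hypPoly_degree {d : ℕ} (hd : 2 ≤ d) (n : ℕ) : (hypPoly d n).natDegree = n := by
  apply le_antisymm
  · rw [natDegree_le_iff_coeff_eq_zero]
    intro k hk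
    rw [hypPoly_coeff, hypCoeff_eq_zero _ _ _ hk]
  · apply le_natDegree_of_ne_zero
    rw [hypPoly_coeff]
    exact hypCoeff_ne_zero hd n n le_rfl

lemma gegPoly_degree {d : ℕ} (hd : 2 ≤ d) (n : ℕ) : (gegPoly d n).degree = n := by
  have h0 : gegPoly d n ≠ 0 := by
    intro h
    have := gegPoly_eval_one d n
    rw [h] at this
    simp at this
  rw [degree_eq_natDegree h0, gegPoly, natDegree_comp, hypPoly_degree hd]
  have : (C (1 / 2 : ℝ) * (1 - X) : ℝ[X]).natDegree = 1 := by
    rw [natDegree_C_mul (by norm_num)]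
    have : (1 - X : ℝ[X]) = -(X - C 1) := by simp
    rw [this, natDegree_neg, natDegree_X_sub_C]
  rw [this, mul_one]

/-- The hypergeometric differential equation, written as a recurrence for the coefficients. -/
lemma hypergeometric_ode_iff (c μ : ℝ) (q : ℝ[X]) :
    X * (1 - X) * derivative (derivative q) + C c * (1 - C 2 * X) * derivative q + C μ * q = 0 ↔
      ∀ k : ℕ, ((k : ℝ) + 1) * (k + c) * q.coeff (k + 1) =
        ((k : ℝ) * (k - 1) + 2 * c * k - μ) * q.coeff k := by
  obtain ⟨e, he⟩ : ∃ e, e = 2 * c := ⟨_, rfl⟩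
  have key : X * (1 - X) * derivative (derivative q) + C c * (1 - C 2 * X) * derivative q + C μ * q
      = X * derivative (derivative q) - X * (X * derivative (derivative q))
        + C c * derivative q - C e * (X * derivative q) + C μ * q := by
    rw [he, C_mul]; ring
  rw [key, Polynomial.ext_iff, ← he]
  refine forall_congr' fun k => ?_
  rcases k with _ | _ | k
  · simp [coeff_derivative]
    constructor <;> intro h <;> linear_combination h
  · simp [coeff_derivative, coeff_X_mul]
    constructor <;> intro h <;> linear_combination h
  · simp [coeff_derivative, coeff_X_mul]
    constructor <;> intro h <;> linear_combination h

lemma eval_gegL (d : ℕ) (q : ℝ[X]) (x : ℝ) :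
    (gegL d q).eval x = ((d : ℝ) - 1) * (x * (derivative q).eval x)
      - (1 - x ^ 2) * (derivative (derivative q)).eval x := by
  simp [gegL]

/-- The substitution `x = 1 - 2t` turns the Gegenbauer operator into the hypergeometric one. -/
lemma gegL_comp (d : ℕ) (q : ℝ[X]) :
    gegL d (q.comp (C (1 / 2) * (1 - X))) =
      -(X * (1 - X) * derivative (derivative q)
        + C (lam d + 1 / 2) * (1 - C 2 * X) * derivative q).comp (C (1 / 2) * (1 - X)) := by
  apply Polynomial.funext
  intro x
  rw [eval_gegL]
  simp only [derivative_comp, derivative_mul, derivative_C, derivative_sub, derivative_one,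
    derivative_X, eval_mul, eval_comp, eval_neg, eval_add, eval_sub, eval_C, eval_X, eval_one,
    eval_zero, derivative_add, derivative_zero]
  unfold lam
  ring

lemma gegL_gegPoly {d : ℕ} (hd : 2 ≤ d) (n : ℕ) :
    gegL d (gegPoly d n) = C (eig d n) * gegPoly d n := by
  have h := (hypergeometric_ode_iff (lam d + 1 / 2) (eig d n) (hypPoly d n)).2 (by
    intro k
    rw [hypPoly_coeff, hypPoly_coeff, hypCoeff_succ hd]
    unfold eig lam
    ring)
  rw [gegPoly, gegL_comp]
  have h2 := congrArg (fun p : ℝ[X] => p.comp (C (1 / 2) * (1 - X))) h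
  simp only [add_comp, zero_comp] at h2 ⊢
  rw [show (C (eig d n) * hypPoly d n).comp (C (1 / 2) * (1 - X))
    = C (eig d n) * (hypPoly d n).comp (C (1 / 2) * (1 - X)) by simp] at h2
  linear_combination -h2

/-- A polynomial eigenfunction of the Gegenbauer operator is determined by its value at `1`. -/
lemma eq_zero_of_gegL_eq {d : ℕ} (hd : 2 ≤ d) (μ : ℝ) (p : ℝ[X]) (hp : gegL d p = C μ * p)
    (h1 : p.eval 1 = 0) : p = 0 := by
  have hl := lam_nonneg hd
  set q := p.comp (1 - C 2 * X) with hq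
  have hpq : p = q.comp (C (1 / 2) * (1 - X)) := by
    apply Polynomial.funext
    intro x
    rw [hq]
    simp only [eval_comp, eval_sub, eval_mul, eval_C, eval_X, eval_one]
    congr 1; ring
  have hode : X * (1 - X) * derivative (derivative q)
      + C (lam d + 1 / 2) * (1 - C 2 * X) * derivative q + C μ * q = 0 := by
    rw [hpq, gegL_comp] at hp
    have h2 := congrArg (fun r : ℝ[X] => r.comp (1 - C 2 * X)) hp
    apply Polynomial.funext
    intro x
    have h3 := congrArg (eval x) h2
    have h4 : (1 / 2 : ℝ) * (1 - (1 - 2 * x)) = x := by ring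
    simp only [neg_comp, mul_comp, eval_neg, eval_add, eval_sub, eval_mul, eval_comp, eval_C,
      eval_X, eval_one, h4, C_comp] at h3
    simp only [eval_add, eval_sub, eval_mul, eval_C, eval_X, eval_one, eval_zero]
    linarith
  rw [hypergeometric_ode_iff] at hode
  have hc : ∀ k, q.coeff k = 0 := by
    intro k
    induction k with
    | zero =>
      rw [coeff_zero_eq_eval_zero, hq]
      simpa using h1
    | succ k ih =>
      have := hode k
      rw [ih, mul_zero] at this
      rcases mul_eq_zero.1 this with h | h
      · exact absurd h (by positivity)
      · exact h
  have : q = 0 := Polynomial.ext (by simpa using hc)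
  rw [hpq, this, zero_comp]

lemma gegL_comp_neg (d : ℕ) (q : ℝ[X]) : gegL d (q.comp (-X)) = (gegL d q).comp (-X) := by
  apply Polynomial.funext
  intro x
  simp only [eval_gegL, eval_comp, derivative_comp, derivative_mul, derivative_neg, derivative_X,
    eval_mul, eval_neg, eval_X, eval_one, eval_zero, derivative_one, eval_add]
  ring

lemma gegL_add (d : ℕ) (p q : ℝ[X]) : gegL d (p + q) = gegL d p + gegL d q := by
  simp [gegL]; ring

lemma gegL_C_mul (d : ℕ) (a : ℝ) (q : ℝ[X]) : gegL d (C a * q) = C a * gegL d q := by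
  simp [gegL]; ring

lemma gegL_sum (d : ℕ) (s : Finset ℕ) (f : ℕ → ℝ[X]) :
    gegL d (∑ i ∈ s, f i) = ∑ i ∈ s, gegL d (f i) := by
  induction s using Finset.induction_on with
  | empty => simp [gegL]
  | insert a s ha ih => rw [Finset.sum_insert ha, Finset.sum_insert ha, gegL_add, ih]

/-- `x ↦ W_n(-x)` is again an eigenfunction, so it equals `W_n(-1) W_n`; evaluation at `-1` gives
the claim. -/
lemma gegPoly_eval_neg_one_sq {d : ℕ} (hd : 2 ≤ d) (n : ℕ) : (gegPoly d n).eval (-1) ^ 2 = 1 := by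
  set p := gegPoly d n
  have h := eq_zero_of_gegL_eq hd (eig d n) (p.comp (-X) + C (-p.eval (-1)) * p) (by
    rw [gegL_add, gegL_comp_neg, gegL_C_mul, gegL_gegPoly hd]
    simp only [mul_comp, C_comp]
    ring) (by simp [p, gegPoly_eval_one])
  have h2 := congrArg (eval (-1)) h
  simp [p, gegPoly_eval_one] at h2
  nlinarith

lemma eig_pos {d : ℕ} (hd : 2 ≤ d) {n : ℕ} (hn : n ≠ 0) : 0 < eig d n := by
  have := two_le_cast hd
  have : (0 : ℝ) < n := by exact_mod_cast Nat.pos_of_ne_zero hn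
  unfold eig
  apply mul_pos this; linarith

/-- Sonin's argument: `W² + (1 - x²) W'² / μ` decreases on `[-1, 0]` and increases on `[0, 1]`,
and it equals `1` at both end points. -/
lemma abs_gegPoly_le {d : ℕ} (hd : 2 ≤ d) (n : ℕ) {x : ℝ} (hx : x ∈ Icc (-1 : ℝ) 1) :
    |(gegPoly d n).eval x| ≤ 1 := by
  rcases Nat.eq_zero_or_pos n with rfl | hn
  · simp [gegPoly, hypPoly, hypCoeff_zero]
  have hmu := eig_pos hd hn.ne'
  have hlam := lam_nonneg hd
  set p := gegPoly d n with hp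
  set g : ℝ → ℝ := fun x => eig d n * p.eval x ^ 2 + (1 - x ^ 2) * (derivative p).eval x ^ 2
    with hg
  have hder : ∀ x, HasDerivAt g (4 * lam d * x * (derivative p).eval x ^ 2) x := by
    intro x
    have h1 := p.hasDerivAt x
    have h2 := (derivative p).hasDerivAt x
    have h3 := ((h1.pow 2).const_mul (eig d n)).add
      ((((hasDerivAt_id x).pow 2).const_sub 1).mul (h2.pow 2))
    have hode := congrArg (eval x) (gegL_gegPoly hd n)
    rw [eval_gegL] at hode
    simp only [eval_mul, eval_C] at hode
    refine h3.congr_deriv ?_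
    rw [← hp] at hode
    simp only [id, Pi.pow_apply]
    unfold lam
    push_cast
    linear_combination (2 * eval x (derivative p)) * -hode
  have hcont : Continuous g := by fun_prop
  have hone : g 1 = eig d n := by simp [hg, hp, gegPoly_eval_one]
  have hneg : g (-1) = eig d n := by
    have := gegPoly_eval_neg_one_sq hd n
    rw [← hp] at this
    simp [hg, this]
  have hle : g x ≤ eig d n := by
    rcases le_total 0 x with h0 | h0
    · rw [← hone]
      refine monotoneOn_of_deriv_nonneg (convex_Icc (0 : ℝ) 1) hcont.continuousOn
        (fun y _ => (hder y).differentiableAt.differentiableWithinAt) (fun y hy => ?_)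
        ⟨h0, hx.2⟩ ⟨zero_le_one, le_rfl⟩ hx.2
      rw [(hder y).deriv]
      rw [interior_Icc] at hy
      have := hy.1.le
      positivity
    · rw [← hneg]
      refine antitoneOn_of_deriv_nonpos (convex_Icc (-1 : ℝ) 0) hcont.continuousOn
        (fun y _ => (hder y).differentiableAt.differentiableWithinAt) (fun y hy => ?_)
        ⟨le_rfl, by norm_num⟩ ⟨hx.1, h0⟩ hx.1
      rw [(hder y).deriv]
      rw [interior_Icc] at hy
      have : 0 ≤ 4 * lam d * -y * (derivative p).eval y ^ 2 := by
        have := hy.2.le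
        have : 0 ≤ -y := by linarith
        positivity
      linarith
  have h5 : 0 ≤ (1 - x ^ 2) * (derivative p).eval x ^ 2 := by
    apply mul_nonneg _ (sq_nonneg _)
    nlinarith [hx.1, hx.2]
  have h6 : eig d n * p.eval x ^ 2 ≤ eig d n * 1 := by
    simp only [hg] at hle
    linarith
  have h7 := le_of_mul_le_mul_left h6 hmu
  rw [← sq_le_one_iff_abs_le_one]
  exact h7

lemma abs_gegW_le {d : ℕ} (hd : 2 ≤ d) (n : ℕ) {x : ℝ} (hx : x ∈ Icc (-1 : ℝ) 1) :
    |gegW d n x| ≤ 1 := by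
  rw [gegW_eq_eval]; exact abs_gegPoly_le hd n hx

lemma gegW_one (d n : ℕ) : gegW d n 1 = 1 := by
  rw [gegW_eq_eval, gegPoly_eval_one]

lemma gegW_zero (d : ℕ) (x : ℝ) : gegW d 0 x = 1 := by
  simp [gegW_eq_sum, hypCoeff_zero]

lemma gegW_index_one {d : ℕ} (hd : 2 ≤ d) (x : ℝ) : gegW d 1 x = x := by
  have h := hypCoeff_succ hd 1 0
  have hl := lam_nonneg hd
  rw [hypCoeff_zero] at h
  have h2 : hypCoeff d 1 1 = -2 := by
    have : (lam d + 1 / 2) * hypCoeff d 1 1 = (lam d + 1 / 2) * (-2) := by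
      push_cast at h
      linarith
    exact mul_left_cancel₀ (by positivity) this
  rw [gegW_eq_sum]
  simp [Finset.sum_range_succ, hypCoeff_zero, h2]
  ring

lemma continuous_gegW (d n : ℕ) : Continuous (gegW d n) := by
  have : gegW d n = fun x => (gegPoly d n).eval x := funext (gegW_eq_eval d n)
  rw [this]; fun_prop

/-! ### Integrals over an interval of functions continuous in its interior -/

lemma intervalIntegrable_of_abs_le {a b : ℝ} (hab : a ≤ b) {f g : ℝ → ℝ}
    (hf : ContinuousOn f (Ioo a b)) (hfg : ∀ x ∈ Ioo a b, |f x| ≤ g x)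
    (hg : IntervalIntegrable g volume a b) : IntervalIntegrable f volume a b := by
  rw [intervalIntegrable_iff_integrableOn_Ioo_of_le hab] at hg ⊢
  refine Integrable.mono' hg (hf.aestronglyMeasurable measurableSet_Ioo) ?_
  filter_upwards [ae_restrict_mem measurableSet_Ioo] with x hx
  simpa using hfg x hx

lemma tendsto_intervalIntegral_of_abs_le {ι : Type*} {l : Filter ι} [l.IsCountablyGenerated]
    {a b : ℝ} (hab : a ≤ b) {F : ι → ℝ → ℝ} {f bound : ℝ → ℝ}
    (hF : ∀ᶠ i in l, ContinuousOn (F i) (Ioo a b))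
    (hb : ∀ᶠ i in l, ∀ x ∈ Ioo a b, |F i x| ≤ bound x)
    (hbi : IntervalIntegrable bound volume a b)
    (hl : ∀ x ∈ Ioo a b, Tendsto (fun i => F i x) l (𝓝 (f x))) :
    Tendsto (fun i => ∫ x in a..b, F i x) l (𝓝 (∫ x in a..b, f x)) := by
  rw [intervalIntegrable_iff_integrableOn_Ioo_of_le hab] at hbi
  simp only [intervalIntegral.integral_of_le hab, integral_Ioc_eq_integral_Ioo]
  refine tendsto_integral_filter_of_dominated_convergence bound ?_ ?_ hbi ?_
  · filter_upwards [hF] with i hi using hi.aestronglyMeasurable measurableSet_Ioo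
  · filter_upwards [hb] with i hi
    filter_upwards [ae_restrict_mem measurableSet_Ioo] with x hx
    simpa using hi x hx
  · filter_upwards [ae_restrict_mem measurableSet_Ioo] with x hx using hl x hx

lemma abs_integral_le_of_abs_le {a b : ℝ} (hab : a ≤ b) {f g : ℝ → ℝ}
    (hfg : ∀ x ∈ Ioo a b, |f x| ≤ g x) (hg : IntervalIntegrable g volume a b) :
    |∫ x in a..b, f x| ≤ ∫ x in a..b, g x := by
  rw [intervalIntegrable_iff_integrableOn_Ioo_of_le hab] at hg
  simp only [intervalIntegral.integral_of_le hab, integral_Ioc_eq_integral_Ioo]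
  rw [← Real.norm_eq_abs]
  refine norm_integral_le_of_norm_le hg ?_
  filter_upwards [ae_restrict_mem measurableSet_Ioo] with x hx
  simpa using hfg x hx

/-! ### The weight and its companion `(1 - x²)^{λ + 1/2}` -/

/-- The function `(1 - x²)^{λ + 1/2}`, through which the Gegenbauer operator has the divergence
form `q ↦ -w⁻¹ ((1 - x²)^{λ + 1/2} q')'`, with `w` the weight. -/
noncomputable def bigWeight (d : ℕ) (x : ℝ) : ℝ := (1 - x ^ 2) ^ (lam d + 1 / 2)

lemma one_sub_sq_pos {x : ℝ} (hx : x ∈ Ioo (-1 : ℝ) 1) : 0 < 1 - x ^ 2 := by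
  nlinarith [hx.1, hx.2]

lemma one_sub_sq_le (x : ℝ) : 1 - x ^ 2 ≤ 1 := by nlinarith

lemma weight_pos (d : ℕ) {x : ℝ} (hx : x ∈ Ioo (-1 : ℝ) 1) : 0 < weight d x :=
  Real.rpow_pos_of_pos (one_sub_sq_pos hx) _

lemma bigWeight_pos (d : ℕ) {x : ℝ} (hx : x ∈ Ioo (-1 : ℝ) 1) : 0 < bigWeight d x :=
  Real.rpow_pos_of_pos (one_sub_sq_pos hx) _

lemma continuousOn_rpow_one_sub_sq (s : ℝ) :
    ContinuousOn (fun x : ℝ => (1 - x ^ 2) ^ s) (Ioo (-1) 1) :=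
  ContinuousOn.rpow_const (by fun_prop) fun _ hx => Or.inl (one_sub_sq_pos hx).ne'

lemma continuousOn_weight (d : ℕ) : ContinuousOn (weight d) (Ioo (-1) 1) :=
  continuousOn_rpow_one_sub_sq _

lemma continuous_bigWeight {d : ℕ} (hd : 2 ≤ d) : Continuous (bigWeight d) := by
  have := lam_nonneg hd
  exact Continuous.rpow_const (by fun_prop) fun _ => Or.inr (by positivity)

lemma bigWeight_neg_one {d : ℕ} (hd : 2 ≤ d) : bigWeight d (-1) = 0 := by
  have := lam_nonneg hd
  have h : lam d + 1 / 2 ≠ 0 := by positivity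
  simp only [bigWeight]
  rw [show (1 - (-1 : ℝ) ^ 2) = 0 by norm_num, Real.zero_rpow h]

lemma bigWeight_one {d : ℕ} (hd : 2 ≤ d) : bigWeight d 1 = 0 := by
  have := lam_nonneg hd
  have h : lam d + 1 / 2 ≠ 0 := by positivity
  simp only [bigWeight]
  rw [show (1 - (1 : ℝ) ^ 2) = 0 by norm_num, Real.zero_rpow h]

lemma bigWeight_eq (d : ℕ) {x : ℝ} (hx : x ∈ Ioo (-1 : ℝ) 1) :
    bigWeight d x = (1 - x ^ 2) * weight d x := by
  unfold bigWeight weight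
  rw [show lam d + 1 / 2 = 1 + (lam d - 1 / 2) by ring, Real.rpow_add (one_sub_sq_pos hx),
    Real.rpow_one]

lemma hasDerivAt_bigWeight (d : ℕ) {x : ℝ} (hx : x ∈ Ioo (-1 : ℝ) 1) :
    HasDerivAt (bigWeight d) (-(((d : ℝ) - 1) * x * weight d x)) x := by
  have h := (((hasDerivAt_id x).pow 2).const_sub 1).rpow_const (p := lam d + 1 / 2)
    (Or.inl (by simpa using (one_sub_sq_pos hx).ne'))
  refine h.congr_deriv ?_
  simp only [id, Pi.pow_apply, weight]
  rw [show lam d + 1 / 2 - 1 = lam d - 1 / 2 by ring]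
  unfold lam
  push_cast
  ring

lemma weight_le {d : ℕ} (hd : 2 ≤ d) {x : ℝ} (hx : x ∈ Ioo (-1 : ℝ) 1) :
    weight d x ≤ (1 - x ^ 2) ^ (-(1 / 2) : ℝ) := by
  have := lam_nonneg hd
  exact Real.rpow_le_rpow_of_exponent_ge (one_sub_sq_pos hx) (one_sub_sq_le x) (by linarith)

lemma intervalIntegrable_chebyshev :
    IntervalIntegrable (fun x : ℝ => (1 - x ^ 2) ^ (-(1 / 2) : ℝ)) volume (-1) 1 := by
  have h : ∀ x ∈ Ioo (-1 : ℝ) 1, (1 - x ^ 2) ^ (-(1 / 2) : ℝ) = 1 / √(1 - x ^ 2) := by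
    intro x hx
    rw [Real.rpow_neg (one_sub_sq_pos hx).le, Real.sqrt_eq_rpow, one_div, one_div]
  apply intervalIntegral.intervalIntegrable_deriv_of_nonneg (g := Real.arcsin)
  · exact Real.continuous_arcsin.continuousOn
  · intro x hx
    simp only [min_eq_left (show (-1 : ℝ) ≤ 1 by norm_num),
      max_eq_right (show (-1 : ℝ) ≤ 1 by norm_num)] at hx
    simp only [h x hx]
    exact Real.hasDerivAt_arcsin hx.1.ne' hx.2.ne
  · intro x hx
    simp only [min_eq_left (show (-1 : ℝ) ≤ 1 by norm_num),
      max_eq_right (show (-1 : ℝ) ≤ 1 by norm_num)] at hx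
    exact Real.rpow_nonneg (one_sub_sq_pos hx).le _

lemma intervalIntegrable_weight {d : ℕ} (hd : 2 ≤ d) :
    IntervalIntegrable (weight d) volume (-1) 1 := by
  refine intervalIntegrable_of_abs_le (by norm_num) (continuousOn_weight d) (fun x hx => ?_)
    intervalIntegrable_chebyshev
  rw [abs_of_pos (weight_pos d hx)]
  exact weight_le hd hx

lemma intervalIntegrable_mono {f : ℝ → ℝ} (hf : IntervalIntegrable f volume (-1) 1) {a b : ℝ}
    (ha : a ∈ Icc (-1 : ℝ) 1) (hb : b ∈ Icc (-1 : ℝ) 1) : IntervalIntegrable f volume a b := by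
  apply hf.mono_set
  rw [uIcc_of_le (show (-1 : ℝ) ≤ 1 by norm_num)]
  exact uIcc_subset_Icc ha hb

lemma intervalIntegrable_weight_mul {d : ℕ} (hd : 2 ≤ d) {f : ℝ → ℝ} (hf : Continuous f) :
    IntervalIntegrable (fun x => weight d x * f x) volume (-1) 1 :=
  (intervalIntegrable_weight hd).mul_continuousOn hf.continuousOn

/-! ### Integration by parts -/

/-- The divergence form of the Gegenbauer operator. -/
lemma integral_weight_gegL {d : ℕ} (hd : 2 ≤ d) (q : ℝ[X]) {y : ℝ} (hy : y ∈ Icc (-1 : ℝ) 1) :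
    ∫ z in (-1 : ℝ)..y, weight d z * (gegL d q).eval z
      = -(bigWeight d y * (derivative q).eval y) := by
  have h := intervalIntegral.integral_eq_sub_of_hasDerivAt_of_le hy.1
    (f := fun z => -(bigWeight d z * (derivative q).eval z))
    (f' := fun z => weight d z * (gegL d q).eval z)
    ((continuous_bigWeight hd).mul (derivative q).continuous).neg.continuousOn
    (fun z hz => by
      have hz' : z ∈ Ioo (-1 : ℝ) 1 := ⟨hz.1, hz.2.trans_le hy.2⟩
      refine ((hasDerivAt_bigWeight d hz').mul ((derivative q).hasDerivAt z)).neg.congr_deriv ?_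
      rw [eval_gegL, bigWeight_eq d hz']
      ring)
    (intervalIntegrable_mono (intervalIntegrable_weight_mul hd (gegL d q).continuous)
      ⟨le_rfl, by norm_num⟩ hy)
  rw [h, bigWeight_neg_one hd]
  ring

lemma outerIntegrand_eq_div {d : ℕ} (f : ℝ → ℝ) {y : ℝ} (hy : y ∈ Ioo (-1 : ℝ) 1) :
    outerIntegrand d f y = (∫ z in (-1 : ℝ)..y, weight d z * f z) / bigWeight d y := by
  unfold outerIntegrand bigWeight
  rw [show -lam d - 1 / 2 = -(lam d + 1 / 2) by ring, Real.rpow_neg (one_sub_sq_pos hy).le]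
  field_simp

/-- `T_λ` inverts the Gegenbauer operator on polynomials, up to a constant. -/
lemma opT_gegL {d : ℕ} (hd : 2 ≤ d) (q : ℝ[X]) {x : ℝ} (hx : x ∈ Icc (-1 : ℝ) 1) :
    opT d (fun z => (gegL d q).eval z) x = q.eval x - q.eval (-1) := by
  unfold opT
  rw [intervalIntegral.integral_congr_Ioo_of_le hx.1 (g := fun y => -(derivative q).eval y)]
  · rw [intervalIntegral.integral_neg, neg_neg]
    exact intervalIntegral.integral_eq_sub_of_hasDerivAt (fun y _ => q.hasDerivAt y)
      ((derivative q).continuous.intervalIntegrable _ _)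
  · intro y hy
    have hy' : y ∈ Ioo (-1 : ℝ) 1 := ⟨hy.1, hy.2.trans_le hx.2⟩
    simp only
    rw [outerIntegrand_eq_div _ hy', integral_weight_gegL hd q ⟨hy'.1.le, hy'.2.le⟩]
    have := (bigWeight_pos d hy').ne'
    field_simp

/-- The Gegenbauer operator is symmetric for the bracket. -/
lemma bracket_gegL_comm {d : ℕ} (hd : 2 ≤ d) (p q : ℝ[X]) :
    bracket d (fun x => (gegL d p).eval x) (fun x => q.eval x) =
      bracket d (fun x => p.eval x) (fun x => (gegL d q).eval x) := by
  have hi1 : IntervalIntegrable (fun x => (gegL d p).eval x * q.eval x * weight d x)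
      volume (-1) 1 := by
    refine (intervalIntegrable_weight_mul hd (f := fun x => (gegL d p).eval x * q.eval x)
      (by fun_prop)).congr fun x _ => by ring
  have hi2 : IntervalIntegrable (fun x => p.eval x * (gegL d q).eval x * weight d x)
      volume (-1) 1 := by
    refine (intervalIntegrable_weight_mul hd (f := fun x => p.eval x * (gegL d q).eval x)
      (by fun_prop)).congr fun x _ => by ring
  have h := intervalIntegral.integral_eq_sub_of_hasDerivAt_of_le (show (-1 : ℝ) ≤ 1 by norm_num)
    (f := fun z => bigWeight d z *
      (p.eval z * (derivative q).eval z - (derivative p).eval z * q.eval z))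
    (f' := fun x => (gegL d p).eval x * q.eval x * weight d x
      - p.eval x * (gegL d q).eval x * weight d x)
    ((continuous_bigWeight hd).mul (by fun_prop)).continuousOn
    (fun z hz => by
      refine ((hasDerivAt_bigWeight d hz).mul
        (((p.hasDerivAt z).mul ((derivative q).hasDerivAt z)).sub
        (((derivative p).hasDerivAt z).mul (q.hasDerivAt z)))).congr_deriv ?_
      rw [eval_gegL, eval_gegL, bigWeight_eq d hz]
      simp only [Pi.sub_apply, Pi.mul_apply]
      ring)
    (hi1.sub hi2)
  rw [bigWeight_neg_one hd, bigWeight_one hd, intervalIntegral.integral_sub hi1 hi2] at h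
  unfold bracket
  linarith

lemma eig_injective {d : ℕ} (hd : 2 ≤ d) {m n : ℕ} (h : eig d m = eig d n) : m = n := by
  have h2 := two_le_cast hd
  have h1 : ((m : ℝ) - n) * (m + n + (d - 2)) = 0 := by unfold eig at h; linarith
  have hm : (0 : ℝ) ≤ m := by positivity
  have hn : (0 : ℝ) ≤ n := by positivity
  rcases mul_eq_zero.1 h1 with h3 | h3
  · exact_mod_cast sub_eq_zero.1 h3
  · have : (m : ℝ) = n := by linarith
    exact_mod_cast this

lemma gegL_gegPoly_eval {d : ℕ} (hd : 2 ≤ d) (n : ℕ) (x : ℝ) :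
    (gegL d (gegPoly d n)).eval x = eig d n * gegW d n x := by
  rw [gegL_gegPoly hd, eval_mul, eval_C, gegW_eq_eval]

lemma bracket_gegW_of_ne {d : ℕ} (hd : 2 ≤ d) {m n : ℕ} (hmn : m ≠ n) :
    bracket d (gegW d m) (gegW d n) = 0 := by
  have h := bracket_gegL_comm hd (gegPoly d m) (gegPoly d n)
  simp only [gegL_gegPoly_eval hd, ← gegW_eq_eval] at h
  have h1 : bracket d (fun x => eig d m * gegW d m x) (fun x => gegW d n x)
      = eig d m * bracket d (gegW d m) (gegW d n) := by
    unfold bracket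
    rw [← intervalIntegral.integral_const_mul]
    congr 1; ext x; ring
  have h2 : bracket d (fun x => gegW d m x) (fun x => eig d n * gegW d n x)
      = eig d n * bracket d (gegW d m) (gegW d n) := by
    unfold bracket
    rw [← intervalIntegral.integral_const_mul]
    congr 1; ext x; ring
  rw [h1, h2] at h
  by_contra h0
  exact hmn (eig_injective hd (mul_right_cancel₀ h0 h))

lemma gegW_zero_eq (d : ℕ) : gegW d 0 = e0 := funext (gegW_zero d)

lemma bracket_e0_gegW {d : ℕ} (hd : 2 ≤ d) {n : ℕ} (hn : n ≠ 0) :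
    bracket d e0 (gegW d n) = 0 := by
  rw [← gegW_zero_eq]
  exact bracket_gegW_of_ne hd hn.symm

lemma bracket_e0_eq (d : ℕ) (f : ℝ → ℝ) :
    bracket d e0 f = ∫ x in (-1 : ℝ)..1, weight d x * f x := by
  unfold bracket e0
  congr 1; ext x; ring

lemma bracket_e0_e0_pos {d : ℕ} (hd : 2 ≤ d) : 0 < bracket d e0 e0 := by
  rw [bracket_e0_eq]
  simp only [e0, mul_one]
  exact intervalIntegral.intervalIntegral_pos_of_pos_on (intervalIntegrable_weight hd)
    (fun x hx => weight_pos d hx) (by norm_num)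

lemma bracket_comm (d : ℕ) (f g : ℝ → ℝ) : bracket d f g = bracket d g f := by
  unfold bracket
  congr 1; ext x; ring

/-- The second moment of the weight; `2 d x² - 2` is the image of `x²` under the Gegenbauer
operator. -/
lemma bracket_gegW_one {d : ℕ} (hd : 2 ≤ d) :
    (d : ℝ) * bracket d (gegW d 1) (gegW d 1) = bracket d e0 e0 := by
  have h := integral_weight_gegL hd (X ^ 2) (y := 1) ⟨by norm_num, le_rfl⟩
  rw [bigWeight_one hd, zero_mul, neg_zero] at h
  have h1 : ∀ z : ℝ, weight d z * (gegL d (X ^ 2)).eval z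
      = (2 * d) * (gegW d 1 z * gegW d 1 z * weight d z) - 2 * (e0 z * e0 z * weight d z) := by
    intro z
    rw [eval_gegL, gegW_index_one hd]
    simp [e0, derivative_pow]
    ring
  simp only [h1] at h
  have hi1 : IntervalIntegrable (fun z => gegW d 1 z * gegW d 1 z * weight d z) volume (-1) 1 :=
    (intervalIntegrable_weight_mul hd
      ((continuous_gegW d 1).mul (continuous_gegW d 1))).congr fun x _ => by simp; ring
  have hi2 : IntervalIntegrable (fun z => e0 z * e0 z * weight d z) volume (-1) 1 := by
    simpa [e0] using intervalIntegrable_weight hd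
  rw [intervalIntegral.integral_sub (hi1.const_mul _) (hi2.const_mul _),
    intervalIntegral.integral_const_mul, intervalIntegral.integral_const_mul] at h
  unfold bracket
  linarith

/-! ### Completeness of the Gegenbauer polynomials -/

/-- The polynomials `W_n^λ` as a sequence of polynomials of degree `n`. -/
noncomputable def gegSequence {d : ℕ} (hd : 2 ≤ d) : Polynomial.Sequence ℝ where
  elems' := gegPoly d
  degree_eq' := gegPoly_degree hd

lemma integral_mul_polynomial_eq_zero {d : ℕ} (hd : 2 ≤ d) {u : ℝ → ℝ}
    (hu : IntervalIntegrable u volume (-1) 1)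
    (h0 : ∀ n, ∫ x in (-1 : ℝ)..1, u x * gegW d n x = 0) (p : ℝ[X]) :
    ∫ x in (-1 : ℝ)..1, u x * p.eval x = 0 := by
  have hi : ∀ q : ℝ[X], IntervalIntegrable (fun x => u x * q.eval x) volume (-1) 1 :=
    fun q => hu.mul_continuousOn q.continuous.continuousOn
  have hp : p ∈ Submodule.span ℝ (Set.range (gegSequence hd)) := by
    rw [(gegSequence hd).span fun i => by simp]
    trivial
  induction hp using Submodule.span_induction with
  | mem q hq =>
    obtain ⟨n, rfl⟩ := hq
    rw [← h0 n]
    congr 1; ext x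
    rw [gegW_eq_eval]; rfl
  | zero => simp
  | add q r _ _ hq hr =>
    simp only [eval_add, mul_add]
    rw [intervalIntegral.integral_add (hi q) (hi r), hq, hr, add_zero]
  | smul a q _ hq =>
    have : ∀ x, u x * (a • q).eval x = a * (u x * q.eval x) := by
      intro x; simp; ring
    simp only [this, intervalIntegral.integral_const_mul, hq, mul_zero]

/-- Orthogonality extends from polynomials to continuous functions by Weierstrass approximation. -/
lemma integral_mul_continuous_eq_zero {d : ℕ} (hd : 2 ≤ d) {u : ℝ → ℝ}
    (hu : IntervalIntegrable u volume (-1) 1)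
    (h0 : ∀ n, ∫ x in (-1 : ℝ)..1, u x * gegW d n x = 0) {φ : ℝ → ℝ} (hφ : Continuous φ) :
    ∫ x in (-1 : ℝ)..1, u x * φ x = 0 := by
  set A := ∫ x in (-1 : ℝ)..1, |u x| with hA
  have hA0 : 0 ≤ A := intervalIntegral.integral_nonneg (by norm_num) fun _ _ => abs_nonneg _
  have key : ∀ ε > 0, |∫ x in (-1 : ℝ)..1, u x * φ x| ≤ ε * A := by
    intro ε hε
    obtain ⟨p, hp⟩ := exists_polynomial_near_of_continuousOn (-1) 1 φ hφ.continuousOn ε hε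
    have h1 : ∫ x in (-1 : ℝ)..1, u x * φ x = ∫ x in (-1 : ℝ)..1, u x * (φ x - p.eval x) := by
      simp only [mul_sub]
      rw [intervalIntegral.integral_sub (hu.mul_continuousOn hφ.continuousOn)
        (hu.mul_continuousOn p.continuous.continuousOn),
        integral_mul_polynomial_eq_zero hd hu h0, sub_zero]
    rw [h1, hA, ← intervalIntegral.integral_const_mul]
    refine abs_integral_le_of_abs_le (by norm_num) (fun x hx => ?_) (hu.abs.const_mul ε)
    rw [abs_mul, mul_comm ε]
    refine mul_le_mul_of_nonneg_left ?_ (abs_nonneg _)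
    rw [abs_sub_comm]
    exact (hp x ⟨hx.1.le, hx.2.le⟩).le
  rw [← abs_eq_zero]
  refine le_antisymm (le_of_forall_pos_le_add fun δ hδ => ?_) (abs_nonneg _)
  refine (key (δ / (A + 1)) (by positivity)).trans ?_
  rw [zero_add, div_mul_eq_mul_div, div_le_iff₀ (by positivity)]
  nlinarith

/-- A function orthogonal to all `W_n^λ` vanishes. -/
lemma eqOn_zero_of_bracket_eq_zero {d : ℕ} (hd : 2 ≤ d) {h : ℝ → ℝ}
    (hc : ContinuousOn h (Ioo (-1) 1))
    (hi : IntervalIntegrable (fun x => h x * weight d x) volume (-1) 1)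
    (h0 : ∀ n, bracket d h (gegW d n) = 0) : EqOn h 0 (Ioo (-1) 1) := by
  have hioo : IntegrableOn (fun x => h x * weight d x) (Ioo (-1) 1) := by
    rwa [intervalIntegrable_iff_integrableOn_Ioo_of_le (by norm_num)] at hi
  have hae := isOpen_Ioo.ae_eq_zero_of_integral_contDiff_smul_eq_zero
    (f := fun x => h x * weight d x) (U := Ioo (-1 : ℝ) 1) (μ := volume)
    hioo.locallyIntegrableOn (by
      intro g hg _ hgs
      have h1 := integral_mul_continuous_eq_zero hd hi (φ := g) (by
        intro n
        rw [← h0 n]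
        unfold bracket
        congr 1; ext x; ring) hg.continuous
      rw [intervalIntegral.integral_of_le (by norm_num), integral_Ioc_eq_integral_Ioo] at h1
      rw [← h1, setIntegral_eq_integral_of_forall_compl_eq_zero]
      · congr 1; ext x; simp [mul_comm]
      · intro x hx
        rw [image_eq_zero_of_notMem_tsupport (fun h => hx (hgs h)), mul_zero])
  have h2 : (fun x => h x * weight d x) =ᵐ[volume.restrict (Ioo (-1) 1)] 0 := by
    rw [EventuallyEq, ae_restrict_iff' measurableSet_Ioo]
    exact hae
  have h3 := Measure.eqOn_open_of_ae_eq h2 isOpen_Ioo (hc.mul (continuousOn_weight d))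
    continuousOn_const
  intro x hx
  have h4 := h3 hx
  simp only [Pi.zero_apply] at h4 ⊢
  exact (mul_eq_zero.1 h4).resolve_right (weight_pos d hx).ne'

lemma Ioo_subset_dom (d m : ℕ) : Ioo (-1 : ℝ) 1 ⊆ dom d m := by
  unfold dom
  split_ifs
  · exact Ioo_subset_Icc_self
  · exact Ioo_subset_Ico_self

lemma dom_subset_Icc (d m : ℕ) : dom d m ⊆ Icc (-1 : ℝ) 1 := by
  unfold dom
  split_ifs
  · exact subset_rfl
  · exact Ico_subset_Icc_self

lemma Ico_subset_dom (d m : ℕ) : Ico (-1 : ℝ) 1 ⊆ dom d m := by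
  unfold dom
  split_ifs
  · exact Ico_subset_Icc_self
  · exact subset_rfl

lemma dom_subset_closure (d m : ℕ) : dom d m ⊆ closure (Ioo (-1 : ℝ) 1) := by
  rw [closure_Ioo (by norm_num)]
  exact dom_subset_Icc d m

lemma intervalIntegrable_mul_gegW {d : ℕ} {f : ℝ → ℝ}
    (hf : IntervalIntegrable (fun x => f x * weight d x) volume (-1) 1) (n : ℕ) :
    IntervalIntegrable (fun x => f x * gegW d n x * weight d x) volume (-1) 1 :=
  (hf.mul_continuousOn (continuous_gegW d n).continuousOn).congr fun x _ => by ring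

/-- The orthogonal expansion determines the spline function. -/
lemma IsSplineFunction.unique {d : ℕ} (hd : 2 ≤ d) {m : ℕ} {f g : ℝ → ℝ}
    (hf : IsSplineFunction d m f) (hg : IsSplineFunction d m g) : EqOn f g (dom d m) := by
  have h := eqOn_zero_of_bracket_eq_zero hd (h := fun x => f x - g x)
    ((hf.continuousOn.mono (Ioo_subset_dom d m)).sub (hg.continuousOn.mono (Ioo_subset_dom d m)))
    ((hf.integrable.sub hg.integrable).congr fun x _ => by ring) (by
      intro n
      have h1 : bracket d (fun x => f x - g x) (gegW d n)
          = bracket d f (gegW d n) - bracket d g (gegW d n) := by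
        unfold bracket
        rw [← intervalIntegral.integral_sub (intervalIntegrable_mul_gegW hf.integrable n)
          (intervalIntegrable_mul_gegW hg.integrable n)]
        congr 1; ext x; ring
      rw [h1, hf.expansion, hg.expansion, sub_self])
  refine EqOn.of_subset_closure (s := Ioo (-1) 1) (fun x hx => ?_) hf.continuousOn hg.continuousOn
    (Ioo_subset_dom d m) (dom_subset_closure d m)
  have := h hx
  simp only [Pi.zero_apply] at this
  linarith

end Thinplate

namespace Thinplate

/-! ### The Poisson kernel as a generating function -/

lemma harmDim_zero (d : ℕ) : harmDim d 0 = 1 := by simp [harmDim]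

/-- Pascal's rule turns `N_{d,n}` into a sum of two binomial coefficients. -/
lemma harmDim_succ (e i : ℕ) :
    harmDim (e + 2) (i + 1) = ((i + 1 + e).choose e : ℝ) + ((i + e).choose e : ℝ) := by
  unfold harmDim
  have h1 : i + 1 + (e + 2) - 1 = i + e + 2 := by omega
  have h2 : (i + e + 2).choose (i + 1) = (i + e + 2).choose (e + 1) := by
    rw [← Nat.choose_symm_of_eq_add]; omega
  rw [h1, h2]
  have h3 : (i + e + 2).choose (e + 1) = (i + e + 1).choose e + (i + e + 1).choose (e + 1) := rfl
  have h4 : (i + e + 1).choose (e + 1) = (i + e).choose e + (i + e).choose (e + 1) := rfl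
  have h6 : i + 1 + e = i + e + 1 := by omega
  rw [h3, h4, h6]
  split_ifs with h
  · obtain ⟨j, rfl⟩ : ∃ j, i = j + 1 := ⟨i - 1, by omega⟩
    have h5 : (j + 1 + 1 + (e + 2) - 3).choose (j + 1 + 1 - 2) = (j + 1 + e).choose (e + 1) := by
      have h7 : j + 1 + 1 + (e + 2) - 3 = j + 1 + e := by omega
      have h8 : j + 1 + 1 - 2 = j := by omega
      rw [h7, h8, ← Nat.choose_symm_of_eq_add]; omega
    rw [h5]; push_cast; ring
  · have : i = 0 := by omega
    subst this
    simp

lemma harmDim_nonneg {d : ℕ} (hd : 2 ≤ d) (n : ℕ) : 0 ≤ harmDim d n := by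
  obtain ⟨e, rfl⟩ : ∃ e, d = e + 2 := ⟨d - 2, by omega⟩
  rcases n with _ | n
  · simp [harmDim_zero]
  · rw [harmDim_succ]; positivity

/-- The effect on `N_{d,n}` of raising the dimension by two and lowering the degree by one. -/
lemma harmDim_ratio (e i : ℕ) :
    harmDim (e + 4) i * (((e : ℝ) + 2) * (e + 1)) =
      ((i : ℝ) + 1) * (i + 1 + e) * harmDim (e + 2) (i + 1) := by
  have hA : ((i + 1 + e).choose e : ℝ) * (i + 1) = (i + e + 1) * ((i + e).choose e : ℝ) := by
    have := Nat.add_one_mul_choose_eq (i + e) i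
    have h1 : (i + e).choose i = (i + e).choose e := by rw [← Nat.choose_symm_of_eq_add]; omega
    have h2 : (i + e + 1).choose (i + 1) = (i + 1 + e).choose e := by
      rw [show i + e + 1 = i + 1 + e by omega, ← Nat.choose_symm_of_eq_add]; omega
    rw [h1, h2] at this
    exact_mod_cast this.symm
  have hB : ((i + e + 1).choose (e + 1) : ℝ) * (e + 1) = (i + e + 1) * ((i + e).choose e : ℝ) := by
    exact_mod_cast (Nat.add_one_mul_choose_eq (i + e) e).symm
  have hC : ((i + e + 2).choose (e + 2) : ℝ) * (e + 2)
      = (i + e + 2) * ((i + e + 1).choose (e + 1) : ℝ) := by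
    exact_mod_cast (Nat.add_one_mul_choose_eq (i + e + 1) (e + 1)).symm
  rw [harmDim_succ]
  rcases i with _ | i
  · have h1 : (0 + 1 + e).choose e = e + 1 := by
      rw [show 0 + 1 + e = e + 1 by ring, Nat.choose_succ_self_right]
    rw [harmDim_zero, h1]
    simp
    ring
  rw [show e + 4 = (e + 2) + 2 by ring, harmDim_succ]
  have hD : ((i + 1 + e).choose (e + 1) : ℝ) * (e + 1) = ((i + 1 + e).choose e : ℝ) * (i + 1) := by
    have := Nat.choose_succ_right_eq (i + 1 + e) e
    rw [show i + 1 + e - e = i + 1 by omega] at this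
    exact_mod_cast this
  have hE : ((i + 2 + e).choose (e + 2) : ℝ) * (e + 2)
      = (i + 2 + e) * ((i + 1 + e).choose (e + 1) : ℝ) := by
    have := Nat.add_one_mul_choose_eq (i + 1 + e) (e + 1)
    rw [show i + 1 + e + 1 = i + 2 + e by omega] at this
    exact_mod_cast this.symm
  rw [show i + 1 + (e + 2) = i + 1 + e + 2 by ring, show i + (e + 2) = i + 2 + e by ring]
  push_cast at *
  linear_combination ((e : ℝ) + 1) * hC + ((i : ℝ) + 1 + e + 2) * hB + ((e : ℝ) + 1) * hE
    + ((i : ℝ) + 2 + e) * hD - ((i : ℝ) + 1 + 1 + e) * hA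

lemma choose_succ_mul (a : ℝ) (k : ℕ) :
    ((k : ℝ) + 1) * Ring.choose a (k + 1) = (a - k) * Ring.choose a k := by
  rw [Ring.choose_eq_smul, Ring.choose_eq_smul, descPochhammer_succ_right,
    Polynomial.smeval_mul, Nat.factorial_succ]
  have h3 : (k.factorial : ℝ) ≠ 0 := by positivity
  simp [Polynomial.smeval_sub, Polynomial.smeval_X, Polynomial.smeval_natCast]
  field_simp

/-- The coefficient of `((1 - x) / 2)^k` in `N_{d,n} W_n^λ` is a multiple, independent of `n`, of
`N_{d+2k,n-k}`; this reflects that the `k`-th derivative of a Gegenbauer polynomial is one for the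
dimension `d + 2k`. -/
lemma harmDim_mul_hypCoeff {d : ℕ} (hd : 2 ≤ d) (k j : ℕ) :
    harmDim d (k + j) * hypCoeff d (k + j) k =
      4 ^ k * Ring.choose (-((d : ℝ) / 2)) k * harmDim (d + 2 * k) j := by
  induction k generalizing j with
  | zero => simp [hypCoeff_zero]
  | succ k ih =>
    have h1 := ih (j + 1)
    rw [show k + (j + 1) = k + 1 + j by ring] at h1
    have h2 := hypCoeff_succ hd (k + 1 + j) k
    have h3 := choose_succ_mul (-((d : ℝ) / 2)) k
    have h4 := harmDim_ratio (d + 2 * k - 2) j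
    rw [show d + 2 * k - 2 + 4 = d + 2 * (k + 1) by omega,
      show d + 2 * k - 2 + 2 = d + 2 * k by omega] at h4
    have h5 : ((d + 2 * k - 2 : ℕ) : ℝ) = d + 2 * k - 2 := by
      rw [Nat.cast_sub (by omega)]; push_cast; ring
    rw [h5] at h4
    have hl := lam_nonneg hd
    have hne : ((k : ℝ) + 1) * (k + (lam d + 1 / 2)) ≠ 0 := by positivity
    apply mul_left_cancel₀ hne
    unfold lam at *
    push_cast at *
    rw [pow_succ]
    linear_combination harmDim d (k + 1 + j) * h2 - (j + 1) * (2 * k + 1 + j + (d - 2)) * h1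
      - ((k : ℝ) + ((d - 2) / 2 + 1 / 2)) * 4 ^ k * 4 * harmDim (d + 2 * (k + 1)) j * h3
      + 4 ^ k * Ring.choose (-((d : ℝ) / 2)) k * h4

lemma hasSum_harmDim {d : ℕ} (hd : 2 ≤ d) {r : ℝ} (hr : |r| < 1) :
    HasSum (fun n => harmDim d n * r ^ n) ((1 + r) / (1 - r) ^ (d - 1)) := by
  obtain ⟨e, rfl⟩ : ∃ e, d = e + 2 := ⟨d - 2, by omega⟩
  have h := hasSum_choose_mul_geometric_of_norm_lt_one e (r := r) hr
  have h1 := (hasSum_nat_add_iff' 1).2 h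
  have h2 := h1.add (h.mul_left r)
  rw [← hasSum_nat_add_iff' 1]
  have hr1 : (1 - r) ≠ 0 := by
    have := (abs_lt.1 hr).2; linarith
  convert h2 using 1
  · ext i
    rw [harmDim_succ]
    ring
  · simp [harmDim_zero]
    field_simp
    ring

lemma summable_harmDim {d : ℕ} (hd : 2 ≤ d) {r : ℝ} (hr : |r| < 1) :
    Summable (fun n => harmDim d n * |r| ^ n) :=
  (hasSum_harmDim hd (r := |r|) (by simpa using hr)).summable

/-- The Poisson kernel `(1 - r²) / (1 - 2rx + r²)^{d/2}`. -/
noncomputable def poisson (d : ℕ) (r x : ℝ) : ℝ :=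
  (1 - r ^ 2) * (1 - 2 * r * x + r ^ 2) ^ (-((d : ℝ) / 2))

/-- For small `r` the generating function is computed by expanding both sides in powers of
`(1 - x) / 2`. -/
lemma hasSum_poisson_of_small {d : ℕ} (hd : 2 ≤ d) {x : ℝ} (hx : x ∈ Icc (-1 : ℝ) 1) {r : ℝ}
    (hr : r ∈ Ioo (0 : ℝ) (1 / 10)) :
    HasSum (fun n => harmDim d n * gegW d n x * r ^ n) (poisson d r x) := by
  obtain ⟨hr0, hr1⟩ := hr
  have hr2 : |r| < 1 := by rw [abs_of_pos hr0]; linarith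
  set t := (1 - x) / 2 with ht
  have ht0 : 0 ≤ t := by have := hx.2; linarith
  have ht1 : t ≤ 1 := by have := hx.1; linarith
  set a : ℝ := -((d : ℝ) / 2) with ha
  have h1r : 0 < 1 - r := by linarith
  set u : ℝ := 4 * (r * t / (1 - r) ^ 2) with hu
  have hu0 : 0 ≤ u := by positivity
  have hu1 : u < 1 := by
    have : r * t / (1 - r) ^ 2 < 1 / 4 := by
      rw [div_lt_iff₀ (by positivity)]
      nlinarith
    linarith
  have huk : ∀ k : ℕ, u ^ k = (4 * (r * t)) ^ k / (1 - r) ^ (2 * k) := by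
    intro k
    rw [hu, pow_mul, ← div_pow]
    congr 1; ring
  set G : ℕ × ℕ → ℝ := fun p =>
    4 ^ p.1 * Ring.choose a p.1 * harmDim (d + 2 * p.1) p.2 * t ^ p.1 * r ^ (p.1 + p.2) with hG
  -- summed over `j` first the double series is a binomial series in `u`, summed along the diagonals
  -- `k + j = n` it is the generating function; `r < 1 / 10` makes `u < 1` for every `x`
  have hinner : ∀ k, HasSum (fun j => G (k, j))
      (Ring.choose a k * u ^ k * ((1 + r) / (1 - r) ^ (d - 1))) := by
    intro k
    have h := (hasSum_harmDim (d := d + 2 * k) (by omega) hr2).mul_left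
      (4 ^ k * Ring.choose a k * t ^ k * r ^ k)
    have h1 : Ring.choose a k * u ^ k * ((1 + r) / (1 - r) ^ (d - 1))
        = 4 ^ k * Ring.choose a k * t ^ k * r ^ k * ((1 + r) / (1 - r) ^ (d + 2 * k - 1)) := by
      rw [huk, show d + 2 * k - 1 = (d - 1) + 2 * k by omega, pow_add, mul_pow, mul_pow]
      field_simp
    have h2 : (fun j => G (k, j)) = fun j =>
        4 ^ k * Ring.choose a k * t ^ k * r ^ k * (harmDim (d + 2 * k) j * r ^ j) := by
      ext j; simp only [hG]; ring
    rw [h1, h2]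
    exact h
  have hbin : HasSum (fun k => Ring.choose a k * u ^ k) ((1 + u) ^ a) := by
    have h := (Real.one_add_rpow_hasFPowerSeriesOnBall_zero (a := a)).hasSum (y := u) (by
      rw [← ENNReal.ofReal_one, Metric.eball_ofReal]
      simpa [abs_of_nonneg hu0] using hu1)
    simpa only [binomialSeries_apply, List.ofFn_const, List.prod_replicate, smul_eq_mul,
      zero_add] using h
  have hsum : Summable G := by
    rw [← summable_abs_iff, summable_prod_of_nonneg (fun _ => abs_nonneg _)]
    have habs : ∀ k, HasSum (fun j => |G (k, j)|)
        (|Ring.choose a k * u ^ k| * ((1 + r) / (1 - r) ^ (d - 1))) := by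
      intro k
      have h := (hasSum_harmDim (d := d + 2 * k) (by omega) hr2).mul_left
        (|4 ^ k * Ring.choose a k * t ^ k * r ^ k|)
      have h1 : |Ring.choose a k * u ^ k| * ((1 + r) / (1 - r) ^ (d - 1))
          = |4 ^ k * Ring.choose a k * t ^ k * r ^ k| *
            ((1 + r) / (1 - r) ^ (d + 2 * k - 1)) := by
        rw [show d + 2 * k - 1 = (d - 1) + 2 * k by omega, pow_add,
          show 4 ^ k * Ring.choose a k * t ^ k * r ^ k = Ring.choose a k * (4 * (r * t)) ^ k by
            rw [mul_pow, mul_pow]; ring,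
          abs_mul, abs_mul, abs_of_nonneg (show 0 ≤ (4 * (r * t)) ^ k by positivity),
          abs_of_nonneg (show 0 ≤ u ^ k by positivity), huk]
        field_simp
      have h2 : (fun j => |G (k, j)|) = fun j =>
          |4 ^ k * Ring.choose a k * t ^ k * r ^ k| * (harmDim (d + 2 * k) j * r ^ j) := by
        ext j
        simp only [hG]
        rw [show 4 ^ k * Ring.choose a k * harmDim (d + 2 * k) j * t ^ k * r ^ (k + j)
          = (4 ^ k * Ring.choose a k * t ^ k * r ^ k) * (harmDim (d + 2 * k) j * r ^ j) by ring,
          abs_mul, abs_of_nonneg (mul_nonneg (harmDim_nonneg (by omega) j) (pow_nonneg hr0.le j))]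
      rw [h1, h2]
      exact h
    refine ⟨fun k => (habs k).summable, ?_⟩
    simp only [fun k => (habs k).tsum_eq]
    exact (hbin.summable.abs).mul_right _
  have htot : HasSum G ((1 + u) ^ a * ((1 + r) / (1 - r) ^ (d - 1))) := by
    have h1 := hsum.hasSum.prod_fiberwise hinner
    rw [(hbin.mul_right _).unique h1]
    exact hsum.hasSum
  have hval : (1 + u) ^ a * ((1 + r) / (1 - r) ^ (d - 1)) = poisson d r x := by
    have h1 : 1 - 2 * r * x + r ^ 2 = (1 - r) ^ 2 * (1 + u) := by
      rw [hu, ht]; field_simp; ring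
    have h2 : ((1 - r) ^ 2) ^ a = ((1 - r) ^ d)⁻¹ := by
      rw [ha, ← Real.rpow_natCast (1 - r) 2, ← Real.rpow_mul h1r.le,
        ← Real.rpow_natCast (1 - r) d, ← Real.rpow_neg h1r.le]
      congr 1; push_cast; ring
    unfold poisson
    rw [h1, Real.mul_rpow (by positivity) (by positivity), h2]
    obtain ⟨e, rfl⟩ : ∃ e, d = e + 1 := ⟨d - 1, by omega⟩
    rw [Nat.add_sub_cancel]
    field_simp
    ring
  rw [hval] at htot
  have h3 := (Finset.HasAntidiagonal.sigmaAntidiagonalEquivProd (A := ℕ)).hasSum_iff.2 htot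
  have h4 := h3.sigma (fun n => hasSum_fintype _)
  convert h4 using 1
  ext n
  simp only [Function.comp_apply, Finset.HasAntidiagonal.sigmaAntidiagonalEquivProd_apply]
  rw [Finset.sum_coe_sort (Finset.HasAntidiagonal.antidiagonal n) (fun p => G p),
    Finset.Nat.sum_antidiagonal_eq_sum_range_succ_mk, gegW_eq_sum, Finset.mul_sum, Finset.sum_mul]
  refine Finset.sum_congr rfl fun k hk => ?_
  have hk' : k ≤ n := by simpa [Nat.lt_succ_iff] using hk
  obtain ⟨j, rfl⟩ := Nat.exists_eq_add_of_le hk'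
  simp only [hG, Nat.add_sub_cancel_left]
  rw [← mul_assoc, harmDim_mul_hypCoeff hd]

lemma poisson_base_pos {r x : ℝ} (hr : |r| < 1) (hx : x ∈ Icc (-1 : ℝ) 1) :
    0 < 1 - 2 * r * x + r ^ 2 := by
  have h1 := abs_lt.1 hr
  have h2 : 1 - 2 * r * x + r ^ 2 = (1 - x ^ 2) + (r - x) ^ 2 := by ring
  by_cases h : x = 1 ∨ x = -1
  · rcases h with rfl | rfl
    · nlinarith
    · nlinarith
  · push Not at h
    have := one_sub_sq_pos ⟨lt_of_le_of_ne hx.1 (Ne.symm h.2), lt_of_le_of_ne hx.2 h.1⟩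
    rw [h2]; positivity

/-- The generating function of the Gegenbauer polynomials is the Poisson kernel. Both sides are
analytic in `r`, so it suffices to compare them for small `r`. -/
lemma tsum_harmDim_mul_gegW {d : ℕ} (hd : 2 ≤ d) {x : ℝ} (hx : x ∈ Icc (-1 : ℝ) 1) {r : ℝ}
    (hr : |r| < 1) : ∑' n, harmDim d n * gegW d n x * r ^ n = poisson d r x := by
  set p := FormalMultilinearSeries.ofScalars ℝ (fun n => harmDim d n * gegW d n x) with hp
  have hrad : 1 ≤ p.radius := by
    refine ENNReal.le_of_forall_nnreal_lt fun s hs => ?_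
    apply p.le_radius_of_summable
    have hs1 : |(s : ℝ)| < 1 := by
      rw [NNReal.abs_eq]; exact_mod_cast hs
    refine Summable.of_nonneg_of_le (fun n => by positivity) (fun n => ?_) (summable_harmDim hd hs1)
    rw [hp, FormalMultilinearSeries.ofScalars_norm, NNReal.abs_eq, norm_mul, Real.norm_eq_abs,
      Real.norm_eq_abs, abs_of_nonneg (harmDim_nonneg hd n)]
    refine mul_le_mul_of_nonneg_right ?_ (by positivity)
    exact mul_le_of_le_one_right (harmDim_nonneg hd n) (abs_gegW_le hd n hx)
  have hsumeq : ∀ s, p.sum s = ∑' n, harmDim d n * gegW d n x * s ^ n := by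
    intro s
    have := FormalMultilinearSeries.ofScalars_sum_eq (fun n => harmDim d n * gegW d n x) s
    exact this
  have hpa : AnalyticOnNhd ℝ p.sum (Ioo (-1) 1) := by
    refine (p.hasFPowerSeriesOnBall (lt_of_lt_of_le one_pos hrad)).analyticOnNhd.mono ?_
    intro s hs
    refine Metric.eball_subset_eball hrad ?_
    rw [← ENNReal.ofReal_one, Metric.eball_ofReal]
    simpa [abs_lt] using hs
  have hqa : AnalyticOnNhd ℝ (fun s => poisson d s x) (Ioo (-1) 1) := by
    intro s hs
    have hpos := poisson_base_pos (abs_lt.2 hs) hx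
    have h1 : AnalyticAt ℝ (fun s : ℝ => 1 - 2 * s * x + s ^ 2) s := by fun_prop
    have h2 : AnalyticAt ℝ (fun s : ℝ => (1 - s ^ 2) *
        Real.exp (Real.log (1 - 2 * s * x + s ^ 2) * (-((d : ℝ) / 2)))) s :=
      AnalyticAt.mul (by fun_prop) ((h1.log hpos).mul analyticAt_const).rexp'
    refine h2.congr ?_
    filter_upwards [isOpen_Ioo.mem_nhds hs] with v hv
    rw [poisson, Real.rpow_def_of_pos (poisson_base_pos (abs_lt.2 hv) hx)]
  have h := hpa.eqOn_of_preconnected_of_eventuallyEq hqa isPreconnected_Ioo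
    (z₀ := 1 / 20) ⟨by norm_num, by norm_num⟩ (by
      filter_upwards [Ioo_mem_nhds (show (0 : ℝ) < 1 / 20 by norm_num)
        (show (1 / 20 : ℝ) < 1 / 10 by norm_num)] with s hs
      rw [hsumeq]
      exact (hasSum_poisson_of_small hd hx hs).tsum_eq)
  rw [← hsumeq]
  exact h (abs_lt.1 hr)

/-! ### Size of the coefficients -/

lemma coeff_zero_index (d m : ℕ) : coeff d m 0 = 0 := by simp [coeff]

lemma coeff_of_ne_zero (d m : ℕ) {n : ℕ} (hn : n ≠ 0) :
    coeff d m n = harmDim d n / eig d n ^ m := by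
  rw [coeff, if_neg hn, eig, mul_comm, div_eq_mul_inv]

lemma coeff_nonneg {d : ℕ} (hd : 2 ≤ d) (m n : ℕ) : 0 ≤ coeff d m n := by
  rcases eq_or_ne n 0 with rfl | hn
  · rw [coeff_zero_index]
  · rw [coeff_of_ne_zero _ _ hn]
    exact div_nonneg (harmDim_nonneg hd n) (pow_nonneg (eig_pos hd hn).le m)

lemma coeff_succ_mul_eig {d : ℕ} (hd : 2 ≤ d) (m n : ℕ) :
    coeff d (m + 1) n * eig d n = coeff d m n := by
  rcases eq_or_ne n 0 with rfl | hn
  · simp [coeff_zero_index]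
  · have := (eig_pos hd hn).ne'
    rw [coeff_of_ne_zero _ _ hn, coeff_of_ne_zero _ _ hn, pow_succ]
    field_simp

lemma sq_le_eig {d : ℕ} (hd : 2 ≤ d) (n : ℕ) : (n : ℝ) ^ 2 ≤ eig d n := by
  have := two_le_cast hd
  have : (0 : ℝ) ≤ n := by positivity
  unfold eig; nlinarith

lemma eig_le {d : ℕ} (hd : 2 ≤ d) {n : ℕ} (hn : n ≠ 0) :
    eig d n ≤ ((d : ℝ) - 1) * (n : ℝ) ^ 2 := by
  have h2 := two_le_cast hd
  have h1 : (1 : ℝ) ≤ n := by exact_mod_cast Nat.one_le_iff_ne_zero.2 hn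
  unfold eig
  have : (n : ℝ) + d - 2 ≤ (d - 1) * n := by nlinarith
  nlinarith

lemma coeff_le_harmDim {d : ℕ} (hd : 2 ≤ d) (m n : ℕ) : coeff d m n ≤ harmDim d n := by
  rcases eq_or_ne n 0 with rfl | hn
  · rw [coeff_zero_index]; exact harmDim_nonneg hd 0
  · rw [coeff_of_ne_zero _ _ hn]
    apply div_le_self (harmDim_nonneg hd n)
    have h1 : (1 : ℝ) ≤ n := by exact_mod_cast Nat.one_le_iff_ne_zero.2 hn
    exact one_le_pow₀ (le_trans (by nlinarith) (sq_le_eig hd n))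

lemma summable_coeff_mul_pow {d : ℕ} (hd : 2 ≤ d) (m : ℕ) {r : ℝ} (hr : |r| < 1) :
    Summable (fun n => |coeff d m n * r ^ n|) := by
  refine Summable.of_nonneg_of_le (fun _ => abs_nonneg _) (fun n => ?_) (summable_harmDim hd hr)
  rw [abs_mul, abs_pow, abs_of_nonneg (coeff_nonneg hd m n)]
  exact mul_le_mul_of_nonneg_right (coeff_le_harmDim hd m n) (by positivity)

lemma harmDim_le (e : ℕ) {n : ℕ} (hn : n ≠ 0) :
    harmDim (e + 2) n ≤ 2 * (1 + (e : ℝ)) ^ e * (n : ℝ) ^ e := by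
  obtain ⟨i, rfl⟩ := Nat.exists_eq_succ_of_ne_zero hn
  have h1 : ((i + 1 + e).choose e : ℝ) ≤ (1 + (e : ℝ)) ^ e * ((i + 1 : ℕ) : ℝ) ^ e := by
    have h2 : ((i + 1 + e).choose e : ℝ) ≤ ((i + 1 + e : ℕ) : ℝ) ^ e := by
      exact_mod_cast Nat.choose_le_pow _ _
    refine h2.trans ?_
    rw [← mul_pow]
    refine pow_le_pow_left₀ (by positivity) ?_ e
    push_cast
    have : (0 : ℝ) ≤ (e : ℝ) * i := by positivity
    nlinarith
  have h3 : ((i + e).choose e : ℝ) ≤ ((i + 1 + e).choose e : ℝ) := by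
    exact_mod_cast Nat.choose_le_choose e (by omega)
  rw [Nat.succ_eq_add_one, harmDim_succ]
  linarith

lemma le_harmDim (e : ℕ) {n : ℕ} (hn : n ≠ 0) :
    (n : ℝ) ^ e / (e.factorial : ℝ) ≤ harmDim (e + 2) n := by
  obtain ⟨i, rfl⟩ := Nat.exists_eq_succ_of_ne_zero hn
  rw [Nat.succ_eq_add_one, harmDim_succ, div_le_iff₀ (by positivity)]
  have h1 := Nat.pow_le_choose (α := ℝ) e (i + 1 + e)
  rw [show i + 1 + e + 1 - e = i + 2 by omega] at h1
  have h2 : ((i + 1 : ℕ) : ℝ) ^ e ≤ ((i + 2 : ℕ) : ℝ) ^ e := by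
    refine pow_le_pow_left₀ (by positivity) ?_ e
    push_cast; linarith
  have h3 : 0 ≤ ((i + e).choose e : ℝ) * (e.factorial : ℝ) := by positivity
  have h4 : ((i + 1 : ℕ) : ℝ) ^ e ≤ (e.factorial : ℝ) * ((i + 1 + e).choose e : ℝ) := by
    refine h2.trans ?_
    rw [div_le_iff₀ (by positivity)] at h1
    linarith
  linarith

/-- The coefficients are of the order of `n^{d-2-2m}`, hence at most of the order of `1/n²`. -/
lemma summable_coeff {d : ℕ} (hd : 2 ≤ d) {m : ℕ} (hm : d ≤ 2 * m) : Summable (coeff d m) := by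
  obtain ⟨e, rfl⟩ : ∃ e, d = e + 2 := ⟨d - 2, by omega⟩
  have h := ((Real.summable_one_div_nat_pow (p := 2)).2 (by norm_num)).mul_left
    (2 * (1 + (e : ℝ)) ^ e)
  refine Summable.of_nonneg_of_le (fun n => coeff_nonneg hd m n) (fun n => ?_) h
  rcases eq_or_ne n 0 with rfl | hn
  · simp [coeff_zero_index]
  have h1 : (1 : ℝ) ≤ n := by exact_mod_cast Nat.one_le_iff_ne_zero.2 hn
  rw [coeff_of_ne_zero _ _ hn]
  have h2 : ((n : ℝ) ^ 2) ^ m ≤ eig (e + 2) n ^ m :=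
    pow_le_pow_left₀ (by positivity) (sq_le_eig hd n) m
  have h3 : (n : ℝ) ^ e * (n : ℝ) ^ 2 ≤ ((n : ℝ) ^ 2) ^ m := by
    rw [← pow_add, ← pow_mul]
    exact pow_le_pow_right₀ h1 hm
  rw [div_le_iff₀ (pow_pos (eig_pos hd hn) m)]
  calc harmDim (e + 2) n ≤ 2 * (1 + (e : ℝ)) ^ e * (n : ℝ) ^ e := harmDim_le e hn
    _ = 2 * (1 + (e : ℝ)) ^ e * (1 / (n : ℝ) ^ 2) * ((n : ℝ) ^ e * (n : ℝ) ^ 2) := by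
        field_simp
    _ ≤ _ := by
        refine mul_le_mul_of_nonneg_left (h3.trans h2) (by positivity)

/-- Since `N_{d,n}` is of the order of `n^{d-2}`, the coefficients are at least of the order of
`n^{d-2-2m}`, hence of `1/n`. -/
lemma tendsto_sum_coeff_atTop {d : ℕ} (hd : 2 ≤ d) {m : ℕ} (hm : 2 * m < d) :
    Tendsto (fun N => ∑ n ∈ Finset.range N, coeff d m n) atTop atTop := by
  rw [← not_summable_iff_tendsto_nat_atTop_of_nonneg (fun n => coeff_nonneg hd m n)]
  obtain ⟨e, rfl⟩ : ∃ e, d = e + 2 := ⟨d - 2, by omega⟩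
  intro hs
  set c : ℝ := (e.factorial : ℝ) * ((e + 2 : ℕ) - 1 : ℝ) ^ m with hc
  have hd1 : (0 : ℝ) < (e + 2 : ℕ) - 1 := by push_cast; linarith [Nat.cast_nonneg (α := ℝ) e]
  have hc0 : 0 < c := by positivity
  refine Real.not_summable_one_div_natCast (Summable.of_nonneg_of_le (fun n => by positivity)
    (fun n => ?_) (hs.mul_left c))
  rcases eq_or_ne n 0 with rfl | hn
  · simp [coeff_zero_index]
  have h1 : (1 : ℝ) ≤ n := by exact_mod_cast Nat.one_le_iff_ne_zero.2 hn
  have hn0 : (0 : ℝ) < n := by linarith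
  rw [coeff_of_ne_zero _ _ hn]
  have h2 : eig (e + 2) n ^ m ≤ ((e + 2 : ℕ) - 1 : ℝ) ^ m * (n : ℝ) ^ (e + 1) := by
    refine (pow_le_pow_left₀ (eig_pos hd hn).le (eig_le hd hn) m).trans ?_
    rw [mul_pow, ← pow_mul]
    exact mul_le_mul_of_nonneg_left (pow_le_pow_right₀ h1 (by omega)) (by positivity)
  have h3 := le_harmDim e hn
  have h4 := pow_pos (eig_pos hd hn) m
  rw [mul_div_assoc', le_div_iff₀ h4, hc]
  calc 1 / (n : ℝ) * eig (e + 2) n ^ m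
      ≤ 1 / (n : ℝ) * (((e + 2 : ℕ) - 1 : ℝ) ^ m * (n : ℝ) ^ (e + 1)) :=
        mul_le_mul_of_nonneg_left h2 (by positivity)
    _ = (e.factorial : ℝ) * ((e + 2 : ℕ) - 1 : ℝ) ^ m * ((n : ℝ) ^ e / (e.factorial : ℝ)) := by
        rw [pow_succ]; field_simp
    _ ≤ _ := mul_le_mul_of_nonneg_left h3 (by positivity)

/-! ### Series of Gegenbauer polynomials with summable coefficients -/

lemma abs_mul_gegW_le {d : ℕ} (hd : 2 ≤ d) (a : ℝ) (n : ℕ) {x : ℝ} (hx : x ∈ Icc (-1 : ℝ) 1) :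
    |a * gegW d n x| ≤ |a| := by
  rw [abs_mul]
  exact mul_le_of_le_one_right (abs_nonneg _) (abs_gegW_le hd n hx)

lemma summable_mul_gegW {d : ℕ} (hd : 2 ≤ d) {a : ℕ → ℝ} (ha : Summable fun n => |a n|) {x : ℝ}
    (hx : x ∈ Icc (-1 : ℝ) 1) : Summable fun n => a n * gegW d n x :=
  Summable.of_abs (Summable.of_nonneg_of_le (fun _ => abs_nonneg _)
    (fun n => abs_mul_gegW_le hd (a n) n hx) ha)

lemma continuousOn_tsum_mul_gegW {d : ℕ} (hd : 2 ≤ d) {a : ℕ → ℝ} (ha : Summable fun n => |a n|) :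
    ContinuousOn (fun x => ∑' n, a n * gegW d n x) (Icc (-1) 1) :=
  continuousOn_tsum (fun n => ((continuous_gegW d n).const_mul (a n)).continuousOn) ha
    fun n _ hx => abs_mul_gegW_le hd (a n) n hx

/-- Termwise integration of a series of Gegenbauer polynomials against an integrable function. -/
lemma hasSum_bracket {d : ℕ} (hd : 2 ≤ d) {a : ℕ → ℝ} (ha : Summable fun n => |a n|) {h : ℝ → ℝ}
    (hh : IntervalIntegrable (fun x => h x * weight d x) volume (-1) 1) :
    HasSum (fun n => a n * bracket d h (gegW d n))
      (bracket d h fun x => ∑' n, a n * gegW d n x) := by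
  have hsub : ∀ t ∈ uIoc (-1 : ℝ) 1, t ∈ Icc (-1 : ℝ) 1 := by
    intro t ht
    rw [uIoc_of_le (by norm_num)] at ht
    exact ⟨ht.1.le, ht.2⟩
  have key := intervalIntegral.hasSum_integral_of_dominated_convergence (μ := volume)
    (a := -1) (b := 1) (F := fun n x => a n * (h x * gegW d n x * weight d x))
    (f := fun x => h x * (∑' n, a n * gegW d n x) * weight d x)
    (fun n x => |a n| * |h x * weight d x|)
    (fun n => ((intervalIntegrable_mul_gegW hh n).const_mul (a n)).def'.1)
    (fun n => Eventually.of_forall fun x hx => by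
      rw [Real.norm_eq_abs,
        show a n * (h x * gegW d n x * weight d x) = a n * gegW d n x * (h x * weight d x) by ring,
        abs_mul]
      exact mul_le_mul_of_nonneg_right (abs_mul_gegW_le hd _ n (hsub x hx)) (abs_nonneg _))
    (Eventually.of_forall fun x _ => ha.mul_right _)
    (by
      simp only [tsum_mul_right]
      exact hh.abs.const_mul _)
    (Eventually.of_forall fun x hx => by
      have h1 := (summable_mul_gegW hd ha (hsub x hx)).hasSum.mul_right (h x * weight d x)
      have h2 : h x * (∑' n, a n * gegW d n x) * weight d x
          = (∑' n, a n * gegW d n x) * (h x * weight d x) := by ring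
      have h3 : (fun n => a n * (h x * gegW d n x * weight d x))
          = fun n => a n * gegW d n x * (h x * weight d x) := by ext n; ring
      simp only [h2, h3]
      exact h1)
  simp only [intervalIntegral.integral_const_mul] at key
  exact key

lemma intervalIntegrable_continuousOn_mul_weight {d : ℕ} (hd : 2 ≤ d) {f : ℝ → ℝ}
    (hf : ContinuousOn f (Icc (-1) 1)) :
    IntervalIntegrable (fun x => f x * weight d x) volume (-1) 1 :=
  ((intervalIntegrable_weight hd).mul_continuousOn (g := f)
    (by rwa [uIcc_of_le (by norm_num)])).congr fun x _ => by ring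

lemma bracket_gegW_tsum {d : ℕ} (hd : 2 ≤ d) {a : ℕ → ℝ} (ha : Summable fun n => |a n|) (k : ℕ) :
    bracket d (gegW d k) (fun x => ∑' n, a n * gegW d n x)
      = a k * bracket d (gegW d k) (gegW d k) := by
  have h := hasSum_bracket hd ha (h := gegW d k)
    (intervalIntegrable_continuousOn_mul_weight hd (continuous_gegW d k).continuousOn)
  refine h.unique ?_
  refine hasSum_single k fun n hn => ?_
  rw [bracket_gegW_of_ne hd hn.symm, mul_zero]

/-! ### Abel means of the spline series -/

/-- The Abel mean `∑ c_n rⁿ W_n^λ(x)` of the series for `k_{d,m}(x)`. -/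
noncomputable def abelSum (d m : ℕ) (r x : ℝ) : ℝ := ∑' n, coeff d m n * r ^ n * gegW d n x

lemma continuousOn_abelSum {d : ℕ} (hd : 2 ≤ d) (m : ℕ) {r : ℝ} (hr : |r| < 1) :
    ContinuousOn (abelSum d m r) (Icc (-1) 1) :=
  continuousOn_tsum_mul_gegW hd (summable_coeff_mul_pow hd m hr)

lemma abelSum_zero {d : ℕ} (hd : 2 ≤ d) {r x : ℝ} (hr : |r| < 1) (hx : x ∈ Icc (-1 : ℝ) 1) :
    abelSum d 0 r x = poisson d r x - 1 := by
  rw [← tsum_harmDim_mul_gegW hd hx hr, abelSum]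
  have hs : Summable fun n => harmDim d n * gegW d n x * r ^ n := by
    have h1 : Summable fun n => |harmDim d n * r ^ n| := by
      refine (summable_harmDim hd hr).congr fun n => ?_
      rw [abs_mul, abs_pow, abs_of_nonneg (harmDim_nonneg hd n)]
    exact (summable_mul_gegW hd h1 hx).congr fun n => by ring
  have hs' : Summable fun n => coeff d 0 n * r ^ n * gegW d n x :=
    summable_mul_gegW hd (summable_coeff_mul_pow hd 0 hr) hx
  rw [hs.tsum_eq_zero_add, hs'.tsum_eq_zero_add, coeff_zero_index, harmDim_zero, gegW_zero]
  simp only [zero_add, pow_zero, mul_one, add_sub_cancel_left]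
  refine tsum_congr fun n => ?_
  rw [coeff_of_ne_zero _ _ (Nat.succ_ne_zero n), pow_zero, div_one]
  ring

lemma bracket_e0_abelSum {d : ℕ} (hd : 2 ≤ d) (m : ℕ) {r : ℝ} (hr : |r| < 1) :
    bracket d e0 (abelSum d m r) = 0 := by
  rw [← gegW_zero_eq]
  unfold abelSum
  rw [bracket_gegW_tsum hd (summable_coeff_mul_pow hd m hr), coeff_zero_index]
  simp

lemma poisson_nonneg {d : ℕ} {r x : ℝ} (hr : |r| < 1) (hx : x ∈ Icc (-1 : ℝ) 1) :
    0 ≤ poisson d r x := by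
  have h1 := abs_lt.1 hr
  have h2 : 0 ≤ 1 - r ^ 2 := by nlinarith
  exact mul_nonneg h2 (Real.rpow_nonneg (poisson_base_pos hr hx).le _)

lemma poisson_le {d : ℕ} {r x : ℝ} (hr : r ∈ Ioo (1 / 2 : ℝ) 1) (hx : x < 1) :
    poisson d r x ≤ (1 - r ^ 2) * (1 - x) ^ (-((d : ℝ) / 2)) := by
  have h2 : 0 ≤ 1 - r ^ 2 := by nlinarith [hr.1, hr.2]
  refine mul_le_mul_of_nonneg_left ?_ h2
  apply Real.rpow_le_rpow_of_nonpos (by linarith)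
  · nlinarith [hr.1, hr.2, sq_nonneg (1 - r)]
  · have : (0 : ℝ) ≤ d := by positivity
    linarith

lemma tendsto_poisson {d : ℕ} {x : ℝ} (hx : x ∈ Ico (-1 : ℝ) 1) :
    Tendsto (fun r => poisson d r x) (𝓝[<] 1) (𝓝 0) := by
  have hev : ∀ᶠ r in 𝓝[<] (1 : ℝ), r ∈ Ioo (1 / 2 : ℝ) 1 := Ioo_mem_nhdsLT (by norm_num)
  have h1 : Tendsto (fun r : ℝ => (1 - r ^ 2) * (1 - x) ^ (-((d : ℝ) / 2))) (𝓝[<] 1) (𝓝 0) := by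
    have : Continuous fun r : ℝ => (1 - r ^ 2) * (1 - x) ^ (-((d : ℝ) / 2)) := by fun_prop
    have h2 := (this.tendsto 1).mono_left (nhdsWithin_le_nhds (s := Iio 1))
    simpa using h2
  refine tendsto_of_tendsto_of_tendsto_of_le_of_le' tendsto_const_nhds h1 ?_ ?_
  · filter_upwards [hev] with r hr
    exact poisson_nonneg (by rw [abs_lt]; constructor <;> linarith [hr.1, hr.2]) ⟨hx.1, hx.2.le⟩
  · filter_upwards [hev] with r hr
    exact poisson_le hr hx.2

/-! ### Bounds and dominated convergence for `T_λ` -/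

/-- The comparison function `(1 - x)^{-λ}`. It is integrable against the weight, locally bounded
on `[-1, 1)`, and bounds by multiples of it are preserved by `T_λ`. -/
noncomputable def majorant (d : ℕ) (x : ℝ) : ℝ := (1 - x) ^ (-lam d)

lemma majorant_nonneg (d : ℕ) {x : ℝ} (hx : x ≤ 1) : 0 ≤ majorant d x :=
  Real.rpow_nonneg (by linarith) _

lemma continuousOn_majorant (d : ℕ) : ContinuousOn (majorant d) (Iio 1) :=
  ContinuousOn.rpow_const (by fun_prop) fun x hx => Or.inl (by
    have := mem_Iio.1 hx
    exact (by linarith : (0 : ℝ) < 1 - x).ne')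

lemma majorant_mono {d : ℕ} (hd : 2 ≤ d) {x y : ℝ} (hxy : x ≤ y) (hy : y < 1) :
    majorant d x ≤ majorant d y := by
  have := lam_nonneg hd
  exact Real.rpow_le_rpow_of_nonpos (by linarith) (by linarith) (by linarith)

lemma one_le_mul_majorant {d : ℕ} (hd : 2 ≤ d) {x : ℝ} (hx : x ∈ Ico (-1 : ℝ) 1) :
    1 ≤ 2 ^ lam d * majorant d x := by
  have hl := lam_nonneg hd
  have h1 : 0 < 1 - x := by linarith [hx.2]
  rw [majorant, Real.rpow_neg h1.le, ← div_eq_mul_inv, le_div_iff₀ (Real.rpow_pos_of_pos h1 _),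
    one_mul]
  exact Real.rpow_le_rpow h1.le (by linarith [hx.1]) hl

lemma rpow_neg_lam_le {d : ℕ} (hd : 2 ≤ d) {y : ℝ} (hy : y ∈ Ico (0 : ℝ) 1) :
    (1 - y ^ 2) ^ (-lam d) ≤ majorant d y := by
  have hl := lam_nonneg hd
  exact Real.rpow_le_rpow_of_nonpos (by linarith [hy.2]) (by nlinarith [hy.1, hy.2]) (by linarith)

lemma weight_mul_majorant_le {d : ℕ} (hd : 2 ≤ d) {x : ℝ} (hx : x ∈ Ioo (-1 : ℝ) 1) :
    weight d x * majorant d x ≤ 2 ^ lam d * (1 - x ^ 2) ^ (-(1 / 2) : ℝ) := by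
  have hl := lam_nonneg hd
  have h1 : 0 < 1 - x := by linarith [hx.2]
  have h2 : 0 < 1 + x := by linarith [hx.1]
  have h3 : weight d x = (1 + x) ^ lam d * (1 - x) ^ lam d * (1 - x ^ 2) ^ (-(1 / 2) : ℝ) := by
    rw [← Real.mul_rpow h2.le h1.le, show (1 + x) * (1 - x) = 1 - x ^ 2 by ring,
      ← Real.rpow_add (one_sub_sq_pos hx)]
    rfl
  have h4 : (1 - x) ^ lam d * majorant d x = 1 := by
    rw [majorant, ← Real.rpow_add h1, add_neg_cancel, Real.rpow_zero]
  have h5 : weight d x * majorant d x = (1 + x) ^ lam d * (1 - x ^ 2) ^ (-(1 / 2) : ℝ) := by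
    rw [h3]; linear_combination (1 + x) ^ lam d * (1 - x ^ 2) ^ (-(1 / 2) : ℝ) * h4
  rw [h5]
  refine mul_le_mul_of_nonneg_right (Real.rpow_le_rpow h2.le (by linarith [hx.2]) hl)
    (Real.rpow_nonneg (one_sub_sq_pos hx).le _)

lemma intervalIntegrable_weight_mul_majorant {d : ℕ} (hd : 2 ≤ d) :
    IntervalIntegrable (fun x => weight d x * majorant d x) volume (-1) 1 := by
  refine intervalIntegrable_of_abs_le (by norm_num)
    ((continuousOn_weight d).mul ((continuousOn_majorant d).mono fun x hx => hx.2))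
    (fun x hx => ?_) (intervalIntegrable_chebyshev.const_mul (2 ^ lam d))
  rw [abs_of_nonneg (mul_nonneg (weight_pos d hx).le (majorant_nonneg d hx.2.le))]
  exact weight_mul_majorant_le hd hx

/-- Near `-1` the mass of the weight on `[-1, y]` is of the order of `(1 - y²)^{λ + 1/2}`. -/
lemma exists_integral_weight_le {d : ℕ} (hd : 2 ≤ d) {x : ℝ} (hx : x < 1) :
    ∃ A, 0 ≤ A ∧ ∀ y ∈ Ioo (-1 : ℝ) x, ∫ z in (-1 : ℝ)..y, weight d z ≤ A * bigWeight d y := by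
  have h2 := two_le_cast hd
  have hd1 : (0 : ℝ) < (d : ℝ) - 1 := by linarith
  have hW := intervalIntegrable_weight hd
  have hpos : ∀ y ∈ Icc (-(1 / 2) : ℝ) x, y ∈ Ioo (-1 : ℝ) 1 := fun y hy =>
    ⟨by linarith [hy.1], by linarith [hy.2]⟩
  obtain ⟨B, hB⟩ := isCompact_Icc.bddAbove_image (f := fun y => (bigWeight d y)⁻¹)
    (K := Icc (-(1 / 2) : ℝ) x)
    ((continuous_bigWeight hd).continuousOn.inv₀ fun y hy => (bigWeight_pos d (hpos y hy)).ne')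
  set M := ∫ z in (-1 : ℝ)..1, weight d z with hM
  have hM0 : 0 ≤ M := by
    have := bracket_e0_e0_pos hd
    rw [bracket_e0_eq] at this
    simpa [e0, hM] using this.le
  refine ⟨2 / ((d : ℝ) - 1) + M * |B|, by positivity, fun y hy => ?_⟩
  have hy1 : y ∈ Ioo (-1 : ℝ) 1 := ⟨hy.1, hy.2.trans hx⟩
  have hbw := bigWeight_pos d hy1
  have hyc : y ∈ Icc (-1 : ℝ) 1 := ⟨hy1.1.le, hy1.2.le⟩
  rcases le_total y (-(1 / 2)) with h | h
  · -- here `1 ≤ -2z` on the range of integration, and `z * weight d z` has the primitive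
    -- `-(bigWeight d z) / (d - 1)`
    have h3 := integral_weight_gegL hd Polynomial.X hyc
    have h4 : ∀ z, weight d z * (gegL d Polynomial.X).eval z
        = ((d : ℝ) - 1) * (z * weight d z) := by
      intro z; rw [eval_gegL]; simp; ring
    simp only [h4, intervalIntegral.integral_const_mul, Polynomial.derivative_X,
      Polynomial.eval_one, mul_one] at h3
    have h5 : ∫ z in (-1 : ℝ)..y, weight d z ≤ ∫ z in (-1 : ℝ)..y, (-2) * (z * weight d z) := by
      refine intervalIntegral.integral_mono_on_of_le_Ioo hy.1.le
        (intervalIntegrable_mono hW ⟨le_rfl, by norm_num⟩ hyc)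
        (intervalIntegrable_mono (((hW.mul_continuousOn (g := fun z => z)
          continuousOn_id).congr fun z _ => by ring).const_mul _) ⟨le_rfl, by norm_num⟩ hyc) ?_
      intro z hz
      have := weight_pos d (x := z) ⟨hz.1, hz.2.trans hy1.2⟩
      nlinarith [hz.2]
    rw [intervalIntegral.integral_const_mul] at h5
    have h6 : ∫ z in (-1 : ℝ)..y, z * weight d z = -(bigWeight d y) / ((d : ℝ) - 1) := by
      field_simp
      linarith
    rw [h6] at h5
    have h7 : 0 ≤ M * |B| * bigWeight d y := by positivity
    calc ∫ z in (-1 : ℝ)..y, weight d z ≤ -2 * (-(bigWeight d y) / ((d : ℝ) - 1)) := h5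
      _ = 2 / ((d : ℝ) - 1) * bigWeight d y := by ring
      _ ≤ _ := by rw [add_mul]; linarith
  · -- away from `-1` and `1` the right-hand side is bounded below
    have h3 : (bigWeight d y)⁻¹ ≤ |B| :=
      (hB (mem_image_of_mem _ ⟨h, hy.2.le⟩)).trans (le_abs_self B)
    have h4 : ∫ z in (-1 : ℝ)..y, weight d z ≤ M := by
      refine intervalIntegral.integral_mono_interval le_rfl hy1.1.le hy1.2.le ?_ hW
      have h0 : ∀ᵐ z ∂volume.restrict (Ioc (-1 : ℝ) 1), z ∈ Ioc (-1 : ℝ) 1 :=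
        ae_restrict_mem measurableSet_Ioc
      filter_upwards [h0] with z hz
      exact Real.rpow_nonneg (by nlinarith [hz.1, hz.2]) _
    have h5 : 1 ≤ |B| * bigWeight d y := by
      rwa [inv_le_iff_one_le_mul₀ hbw] at h3
    have h6 : 0 ≤ 2 / ((d : ℝ) - 1) * bigWeight d y := by positivity
    rw [add_mul, mul_assoc]
    nlinarith

lemma abs_primitive_le {d : ℕ} (hd : 2 ≤ d) {f : ℝ → ℝ} {C y : ℝ} (hy : y ∈ Icc (-1 : ℝ) 1)
    (hf : ∀ z ∈ Ioo (-1 : ℝ) y, |f z| ≤ C) :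
    |∫ z in (-1 : ℝ)..y, weight d z * f z| ≤ C * ∫ z in (-1 : ℝ)..y, weight d z := by
  rw [← intervalIntegral.integral_const_mul]
  refine abs_integral_le_of_abs_le hy.1 (fun z hz => ?_)
    ((intervalIntegrable_mono (intervalIntegrable_weight hd) ⟨le_rfl, by norm_num⟩ hy).const_mul C)
  have hw := weight_pos d (x := z) ⟨hz.1, hz.2.trans_le hy.2⟩
  rw [abs_mul, abs_of_pos hw, mul_comm]
  exact mul_le_mul_of_nonneg_right (hf z hz) hw.le

/-- A function bounded on `(-1, x)` has a bounded outer integrand there. -/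
lemma exists_abs_outerIntegrand_le {d : ℕ} (hd : 2 ≤ d) {x : ℝ} (hx : x < 1) :
    ∃ A, 0 ≤ A ∧ ∀ (f : ℝ → ℝ) (C : ℝ), (∀ z ∈ Ioo (-1 : ℝ) x, |f z| ≤ C) →
      ∀ y ∈ Ioo (-1 : ℝ) x, |outerIntegrand d f y| ≤ C * A := by
  obtain ⟨A, hA0, hA⟩ := exists_integral_weight_le hd hx
  refine ⟨A, hA0, fun f C hf y hy => ?_⟩
  have hy1 : y ∈ Ioo (-1 : ℝ) 1 := ⟨hy.1, hy.2.trans hx⟩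
  have hC : 0 ≤ C := (abs_nonneg _).trans (hf y hy)
  have hbw := bigWeight_pos d hy1
  rw [outerIntegrand_eq_div _ hy1, abs_div, abs_of_pos hbw, div_le_iff₀ hbw, mul_assoc]
  refine (abs_primitive_le hd ⟨hy1.1.le, hy1.2.le⟩ fun z hz =>
    hf z ⟨hz.1, hz.2.trans hy.2⟩).trans ?_
  exact mul_le_mul_of_nonneg_left (hA y hy) hC

/-- Conditions under which all integrals in `T_λ f(x)` converge for `x < 1`: the weighted integral
of `f` exists, and `f` is bounded near `-1`, where `(1 - y²)^{-λ-1/2}` is not integrable. -/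
structure Admissible (d : ℕ) (f : ℝ → ℝ) : Prop where
  continuousOn : ContinuousOn f (Ioo (-1) 1)
  integrable : IntervalIntegrable (fun z => weight d z * f z) volume (-1) 1
  locBdd : ∀ x < 1, ∃ C, ∀ z ∈ Ioo (-1 : ℝ) x, |f z| ≤ C

lemma admissible_of_le_majorant {d : ℕ} (hd : 2 ≤ d) {f : ℝ → ℝ} {C : ℝ}
    (hf : ContinuousOn f (Ioo (-1) 1)) (hC : ∀ x ∈ Ioo (-1 : ℝ) 1, |f x| ≤ C * majorant d x) :
    Admissible d f where
  continuousOn := hf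
  integrable := by
    refine intervalIntegrable_of_abs_le (by norm_num) ((continuousOn_weight d).mul hf)
      (fun x hx => ?_) ((intervalIntegrable_weight_mul_majorant hd).const_mul C)
    have hw := weight_pos d hx
    rw [abs_mul, abs_of_pos hw]
    have := mul_le_mul_of_nonneg_left (hC x hx) hw.le
    linarith
  locBdd := by
    intro x hx
    refine ⟨|C| * majorant d x, fun z hz => (hC z ⟨hz.1, hz.2.trans hx⟩).trans ?_⟩
    exact mul_le_mul (le_abs_self C) (majorant_mono hd hz.2.le hx)
      (majorant_nonneg d (hz.2.trans hx).le) (abs_nonneg C)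

lemma admissible_of_continuousOn {d : ℕ} (hd : 2 ≤ d) {f : ℝ → ℝ}
    (hf : ContinuousOn f (Icc (-1) 1)) : Admissible d f where
  continuousOn := hf.mono Ioo_subset_Icc_self
  integrable := (intervalIntegrable_continuousOn_mul_weight hd hf).congr fun x _ => by ring
  locBdd := by
    intro x hx
    obtain ⟨C, hC⟩ := isCompact_Icc.exists_bound_of_continuousOn hf
    exact ⟨C, fun z hz => hC z ⟨hz.1.le, (hz.2.trans hx).le⟩⟩

lemma Admissible.continuousOn_outerIntegrand {d : ℕ} {f : ℝ → ℝ} (hf : Admissible d f) :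
    ContinuousOn (outerIntegrand d f) (Ioo (-1) 1) := by
  have h1 := intervalIntegral.continuousOn_primitive_interval' hf.integrable
    (left_mem_uIcc (a := (-1 : ℝ)) (b := 1))
  rw [uIcc_of_le (by norm_num)] at h1
  exact (continuousOn_rpow_one_sub_sq _).mul (h1.mono Ioo_subset_Icc_self)

lemma Admissible.intervalIntegrable_outerIntegrand {d : ℕ} (hd : 2 ≤ d) {f : ℝ → ℝ}
    (hf : Admissible d f) {x : ℝ} (hx : x ∈ Ico (-1 : ℝ) 1) :
    IntervalIntegrable (outerIntegrand d f) volume (-1) x := by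
  obtain ⟨C, hC⟩ := hf.locBdd x hx.2
  obtain ⟨A, _, hA⟩ := exists_abs_outerIntegrand_le hd hx.2
  exact intervalIntegrable_of_abs_le hx.1
    (hf.continuousOn_outerIntegrand.mono (Ioo_subset_Ioo_right hx.2.le)) (hA f C hC)
    intervalIntegrable_const

lemma continuousOn_opT_of_intervalIntegrable {d : ℕ} {f : ℝ → ℝ} {b : ℝ} (hb : -1 ≤ b)
    (h : IntervalIntegrable (outerIntegrand d f) volume (-1) b) :
    ContinuousOn (opT d f) (Icc (-1) b) := by
  have h1 := intervalIntegral.continuousOn_primitive_interval' h (left_mem_uIcc)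
  rw [uIcc_of_le hb] at h1
  exact h1.neg

lemma Admissible.continuousOn_opT {d : ℕ} (hd : 2 ≤ d) {f : ℝ → ℝ} (hf : Admissible d f) :
    ContinuousOn (opT d f) (Ico (-1) 1) := by
  intro x hx
  obtain ⟨b, hb1, hb2⟩ := exists_between hx.2
  have h1 := continuousOn_opT_of_intervalIntegrable (hx.1.trans hb1.le)
    (hf.intervalIntegrable_outerIntegrand hd ⟨hx.1.trans hb1.le, hb2⟩) x ⟨hx.1, hb1.le⟩
  refine h1.mono_of_mem_nhdsWithin ?_
  filter_upwards [self_mem_nhdsWithin, mem_nhdsWithin_of_mem_nhds (Iio_mem_nhds hb1)] with y hy hy2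
  exact ⟨hy.1, (mem_Iio.1 hy2).le⟩

/-- Bounds on `f` near `-1` and on the mass of `f` up to a point bound `T_λ f` by the majorant. -/
lemma exists_abs_opT_le {d : ℕ} (hd : 2 ≤ d) :
    ∃ A, 0 ≤ A ∧ ∀ (f : ℝ → ℝ) (C : ℝ), (∀ z ∈ Ioo (-1 : ℝ) 0, |f z| ≤ C) →
      (∀ y ∈ Ico (0 : ℝ) 1, |∫ z in (-1 : ℝ)..y, weight d z * f z| ≤ C) →
      ∀ x ∈ Ico (-1 : ℝ) 1, |opT d f x| ≤ C * A * majorant d x := by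
  obtain ⟨A, hA0, hA⟩ := exists_abs_outerIntegrand_le hd (x := 0) one_pos
  have hl := lam_nonneg hd
  set I := ∫ y in (-1 : ℝ)..1, (1 - y ^ 2) ^ (-(1 / 2) : ℝ) with hI
  have hnn : ∀ y ∈ Icc (-1 : ℝ) 1, 0 ≤ (1 - y ^ 2) ^ (-(1 / 2) : ℝ) := fun y hy =>
    Real.rpow_nonneg (by nlinarith [hy.1, hy.2]) _
  have hI0 : 0 ≤ I := intervalIntegral.integral_nonneg (by norm_num) hnn
  refine ⟨(A * 2 ^ lam d + 1) * I, by positivity, fun f C hf hF x hx => ?_⟩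
  have hC : 0 ≤ C := (abs_nonneg _).trans (hF 0 ⟨le_rfl, one_pos⟩)
  have hmx := majorant_nonneg d hx.2.le
  have hone := one_le_mul_majorant hd hx
  -- of the factor `(1 - y²)^{-λ-1/2}` the power `-λ` goes into the majorant, which is monotone, and
  -- the power `-1/2` stays as an integrable function
  have hpt : ∀ y ∈ Ioo (-1 : ℝ) x, |outerIntegrand d f y|
      ≤ C * (A * 2 ^ lam d + 1) * majorant d x * (1 - y ^ 2) ^ (-(1 / 2) : ℝ) := by
    intro y hy
    have hy1 : y ∈ Ioo (-1 : ℝ) 1 := ⟨hy.1, hy.2.trans hx.2⟩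
    have hq : 1 ≤ (1 - y ^ 2) ^ (-(1 / 2) : ℝ) :=
      Real.one_le_rpow_of_pos_of_le_one_of_nonpos (one_sub_sq_pos hy1) (one_sub_sq_le y)
        (by norm_num)
    rcases lt_or_ge y 0 with h0 | h0
    · have h1 := hA f C hf y ⟨hy.1, h0⟩
      have h2 : C * A * 1 ≤ C * A * (2 ^ lam d * majorant d x) :=
        mul_le_mul_of_nonneg_left hone (by positivity)
      have h3 : 0 ≤ C * (A * 2 ^ lam d + 1) * majorant d x := by positivity
      have h4 : C * A ≤ C * (A * 2 ^ lam d + 1) * majorant d x := by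
        have : 0 ≤ C * majorant d x := by positivity
        nlinarith
      calc |outerIntegrand d f y| ≤ C * (A * 2 ^ lam d + 1) * majorant d x * 1 := by linarith
        _ ≤ _ := mul_le_mul_of_nonneg_left hq h3
    · have hbw := bigWeight_pos d hy1
      rw [outerIntegrand_eq_div _ hy1, abs_div, abs_of_pos hbw]
      have h1 : (bigWeight d y)⁻¹ = (1 - y ^ 2) ^ (-lam d) * (1 - y ^ 2) ^ (-(1 / 2) : ℝ) := by
        rw [← Real.rpow_add (one_sub_sq_pos hy1), bigWeight,
          ← Real.rpow_neg (one_sub_sq_pos hy1).le]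
        congr 1; ring
      have h2 : (1 - y ^ 2) ^ (-lam d) ≤ majorant d x :=
        (rpow_neg_lam_le hd ⟨h0, hy1.2⟩).trans (majorant_mono hd hy.2.le hx.2)
      rw [div_eq_mul_inv, h1, ← mul_assoc]
      refine mul_le_mul_of_nonneg_right ?_ (hnn y ⟨hy1.1.le, hy1.2.le⟩)
      refine (mul_le_mul (hF y ⟨h0, hy1.2⟩) h2
        (Real.rpow_nonneg (one_sub_sq_pos hy1).le _) hC).trans ?_
      have : 0 ≤ C * (A * 2 ^ lam d) * majorant d x := by positivity
      nlinarith
  have hint := intervalIntegrable_chebyshev.const_mul (C * (A * 2 ^ lam d + 1) * majorant d x)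
  have hxc : x ∈ Icc (-1 : ℝ) 1 := ⟨hx.1, hx.2.le⟩
  unfold opT
  rw [abs_neg]
  refine (abs_integral_le_of_abs_le hx.1 hpt
    (intervalIntegrable_mono hint ⟨le_rfl, by norm_num⟩ hxc)).trans ?_
  rw [intervalIntegral.integral_const_mul]
  have h1 : ∫ y in (-1 : ℝ)..x, (1 - y ^ 2) ^ (-(1 / 2) : ℝ) ≤ I := by
    refine intervalIntegral.integral_mono_interval le_rfl hx.1 hx.2.le ?_
      intervalIntegrable_chebyshev
    have h0 : ∀ᵐ z ∂volume.restrict (Ioc (-1 : ℝ) 1), z ∈ Ioc (-1 : ℝ) 1 :=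
      ae_restrict_mem measurableSet_Ioc
    filter_upwards [h0] with z hz using hnn z ⟨hz.1.le, hz.2⟩
  calc _ ≤ C * (A * 2 ^ lam d + 1) * majorant d x * I :=
        mul_le_mul_of_nonneg_left h1 (by positivity)
    _ = _ := by ring

lemma tendsto_opT {d : ℕ} (hd : 2 ≤ d) {ι : Type*} {l : Filter ι} [l.IsCountablyGenerated]
    {F : ι → ℝ → ℝ} {f : ℝ → ℝ} (hF : ∀ᶠ i in l, Admissible d (F i))
    (hb : ∀ x < 1, ∃ C, ∀ᶠ i in l, ∀ z ∈ Ioo (-1 : ℝ) x, |F i z| ≤ C)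
    (hl : ∀ x ∈ Ioo (-1 : ℝ) 1, Tendsto (fun i => F i x) l (𝓝 (f x)))
    {x : ℝ} (hx : x ∈ Ico (-1 : ℝ) 1) :
    Tendsto (fun i => opT d (F i) x) l (𝓝 (opT d f x)) := by
  obtain ⟨C, hC⟩ := hb x hx.2
  obtain ⟨A, hA0, hA⟩ := exists_abs_outerIntegrand_le hd hx.2
  refine Tendsto.neg ?_
  refine tendsto_intervalIntegral_of_abs_le hx.1 (bound := fun _ => C * A) ?_ ?_
    intervalIntegrable_const ?_
  · filter_upwards [hF] with i hi
    exact hi.continuousOn_outerIntegrand.mono (Ioo_subset_Ioo_right hx.2.le)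
  · filter_upwards [hC] with i hi
    exact hA (F i) C hi
  · intro y hy
    refine Tendsto.const_mul _ ?_
    have hsub : Ioo (-1 : ℝ) y ⊆ Ioo (-1) 1 := Ioo_subset_Ioo_right (hy.2.trans hx.2).le
    refine tendsto_intervalIntegral_of_abs_le hy.1.le (bound := fun z => C * weight d z) ?_ ?_
      ((intervalIntegrable_mono (intervalIntegrable_weight hd) ⟨le_rfl, by norm_num⟩
        ⟨hy.1.le, (hy.2.trans hx.2).le⟩).const_mul C) ?_
    · filter_upwards [hF] with i hi
      exact ((continuousOn_weight d).mul hi.continuousOn).mono hsub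
    · filter_upwards [hC] with i hi z hz
      have hw := weight_pos d (hsub hz)
      rw [abs_mul, abs_of_pos hw, mul_comm]
      exact mul_le_mul_of_nonneg_right (hi z ⟨hz.1, hz.2.trans hy.2⟩) hw.le
    · intro z hz
      exact (hl z (hsub hz)).const_mul _

lemma tendsto_bracket_gegW {d : ℕ} (hd : 2 ≤ d) {ι : Type*} {l : Filter ι}
    [l.IsCountablyGenerated] {F : ι → ℝ → ℝ} {f : ℝ → ℝ} {C : ℝ}
    (hF : ∀ᶠ i in l, ContinuousOn (F i) (Ioo (-1) 1))
    (hb : ∀ᶠ i in l, ∀ x ∈ Ioo (-1 : ℝ) 1, |F i x| ≤ C * majorant d x)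
    (hl : ∀ x ∈ Ioo (-1 : ℝ) 1, Tendsto (fun i => F i x) l (𝓝 (f x))) (n : ℕ) :
    Tendsto (fun i => bracket d (F i) (gegW d n)) l (𝓝 (bracket d f (gegW d n))) := by
  refine tendsto_intervalIntegral_of_abs_le (by norm_num)
    (bound := fun x => C * (weight d x * majorant d x)) ?_ ?_
    ((intervalIntegrable_weight_mul_majorant hd).const_mul C) ?_
  · filter_upwards [hF] with i hi
    exact (hi.mul (continuous_gegW d n).continuousOn).mul (continuousOn_weight d)
  · filter_upwards [hb] with i hi x hx
    have hw := weight_pos d hx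
    rw [abs_mul, abs_of_pos hw, mul_comm (weight d x), ← mul_assoc]
    refine mul_le_mul_of_nonneg_right ?_ hw.le
    rw [mul_comm (F i x)]
    rw [mul_comm]
    exact (abs_mul_gegW_le hd _ n ⟨hx.1.le, hx.2.le⟩).trans (hi x hx)
  · intro x hx
    exact ((hl x hx).mul_const _).mul_const _

/-! ### The recurrence and its action on Abel means -/

/-- One step of the recurrence: `T_λ f` minus its weighted mean. -/
noncomputable def centeredT (d : ℕ) (f : ℝ → ℝ) (x : ℝ) : ℝ :=
  opT d f x - bracket d e0 (opT d f) / bracket d e0 e0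

/-- The functions generated by the recurrence, started at index `0` with the constant `-1`. This
constant is the pointwise limit on `[-1, 1)` of the Abel means of `∑_{n ≥ 1} N_{d,n} W_n^λ`. -/
noncomputable def spline (d : ℕ) : ℕ → ℝ → ℝ
  | 0 => fun _ => -1
  | m + 1 => centeredT d (spline d m)

lemma bracket_e0_const (d : ℕ) (c : ℝ) : bracket d e0 (fun _ => c) = c * bracket d e0 e0 := by
  rw [bracket_e0_eq, bracket_e0_eq, ← intervalIntegral.integral_const_mul]
  congr 1; ext x; simp [e0]; ring

lemma bracket_e0_sub_const {d : ℕ} (hd : 2 ≤ d) {f : ℝ → ℝ} (c : ℝ)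
    (hf : IntervalIntegrable (fun x => weight d x * f x) volume (-1) 1) :
    bracket d e0 (fun x => f x - c) = bracket d e0 f - c * bracket d e0 e0 := by
  rw [← bracket_e0_const, bracket_e0_eq, bracket_e0_eq, bracket_e0_eq,
    ← intervalIntegral.integral_sub hf ((intervalIntegrable_weight hd).mul_const c)]
  congr 1; ext x; ring

lemma bracket_congr {d : ℕ} {f f' g : ℝ → ℝ} (h : EqOn f f' (Ioo (-1) 1)) :
    bracket d g f = bracket d g f' := by
  refine intervalIntegral.integral_congr_Ioo_of_le (by norm_num) fun x hx => ?_
  simp only [h hx]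

lemma integral_weight_majorant_nonneg (d : ℕ) :
    0 ≤ ∫ x in (-1 : ℝ)..1, weight d x * majorant d x :=
  intervalIntegral.integral_nonneg (by norm_num) fun x hx =>
    mul_nonneg (Real.rpow_nonneg (by nlinarith [hx.1, hx.2]) _) (majorant_nonneg d hx.2)

lemma abs_primitive_le_of_le_majorant {d : ℕ} (hd : 2 ≤ d) {f : ℝ → ℝ} {C : ℝ}
    (hC : ∀ x ∈ Ioo (-1 : ℝ) 1, |f x| ≤ C * majorant d x) {y : ℝ} (hy : y ∈ Icc (-1 : ℝ) 1) :
    |∫ z in (-1 : ℝ)..y, weight d z * f z| ≤ C * ∫ x in (-1 : ℝ)..1, weight d x * majorant d x := by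
  have hC0 : 0 ≤ C := by
    have h1 := (abs_nonneg _).trans (hC 0 ⟨by norm_num, one_pos⟩)
    simpa [majorant] using h1
  have hint := (intervalIntegrable_weight_mul_majorant hd).const_mul C
  have h1 : |∫ z in (-1 : ℝ)..y, weight d z * f z|
      ≤ ∫ z in (-1 : ℝ)..y, C * (weight d z * majorant d z) := by
    refine abs_integral_le_of_abs_le hy.1 (fun z hz => ?_)
      (intervalIntegrable_mono hint ⟨le_rfl, by norm_num⟩ hy)
    have hz' : z ∈ Ioo (-1 : ℝ) 1 := ⟨hz.1, hz.2.trans_le hy.2⟩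
    have hw := weight_pos d hz'
    rw [abs_mul, abs_of_pos hw]
    have := mul_le_mul_of_nonneg_left (hC z hz') hw.le
    linarith
  rw [← intervalIntegral.integral_const_mul]
  refine h1.trans (intervalIntegral.integral_mono_interval le_rfl hy.1 hy.2 ?_ hint)
  have h0 : ∀ᵐ z ∂volume.restrict (Ioc (-1 : ℝ) 1), z ∈ Ioc (-1 : ℝ) 1 :=
    ae_restrict_mem measurableSet_Ioc
  filter_upwards [h0] with z hz
  exact mul_nonneg hC0 (mul_nonneg (Real.rpow_nonneg (by nlinarith [hz.1, hz.2]) _)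
    (majorant_nonneg d hz.2))

/-- If `T_λ f` is bounded by a multiple of the majorant, so is its centered version. -/
lemma exists_abs_centeredT_le {d : ℕ} (hd : 2 ≤ d) :
    ∃ A, 0 ≤ A ∧ ∀ (f : ℝ → ℝ) (C : ℝ), (∀ x ∈ Ico (-1 : ℝ) 1, |opT d f x| ≤ C * majorant d x) →
      ∀ x ∈ Ico (-1 : ℝ) 1, |centeredT d f x| ≤ C * A * majorant d x := by
  have hB := bracket_e0_e0_pos hd
  set J := ∫ x in (-1 : ℝ)..1, weight d x * majorant d x with hJ
  have hJ0 : 0 ≤ J := integral_weight_majorant_nonneg d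
  refine ⟨1 + J / bracket d e0 e0 * 2 ^ lam d, by positivity, fun f C hC x hx => ?_⟩
  have h1 : |bracket d e0 (opT d f)| ≤ C * J := by
    rw [bracket_e0_eq]
    exact abs_primitive_le_of_le_majorant hd (fun z hz => hC z ⟨hz.1.le, hz.2⟩)
      ⟨by norm_num, le_rfl⟩
  have hC0 : 0 ≤ C := by
    have h1 := (abs_nonneg _).trans (hC 0 ⟨by norm_num, one_pos⟩)
    simpa [majorant] using h1
  have h2 : |bracket d e0 (opT d f) / bracket d e0 e0| ≤ C * J / bracket d e0 e0 := by
    rw [abs_div, abs_of_pos hB]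
    exact div_le_div_of_nonneg_right h1 hB.le
  have h3 : C * J / bracket d e0 e0 * 1
      ≤ C * J / bracket d e0 e0 * (2 ^ lam d * majorant d x) :=
    mul_le_mul_of_nonneg_left (one_le_mul_majorant hd hx) (by positivity)
  calc |centeredT d f x| ≤ |opT d f x| + |bracket d e0 (opT d f) / bracket d e0 e0| := abs_sub _ _
    _ ≤ C * majorant d x + C * J / bracket d e0 e0 * (2 ^ lam d * majorant d x) := by
        have := hC x hx
        linarith
    _ = _ := by ring

/-- Dominated convergence for one step of the recurrence. -/
lemma tendsto_centeredT {d : ℕ} (hd : 2 ≤ d) {ι : Type*} {l : Filter ι} [l.IsCountablyGenerated]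
    {F : ι → ℝ → ℝ} {f : ℝ → ℝ} (hF : ∀ᶠ i in l, Admissible d (F i))
    (hb : ∀ x < 1, ∃ C, ∀ᶠ i in l, ∀ z ∈ Ioo (-1 : ℝ) x, |F i z| ≤ C)
    (hm : ∃ C, ∀ᶠ i in l, ∀ y ∈ Ico (0 : ℝ) 1, |∫ z in (-1 : ℝ)..y, weight d z * F i z| ≤ C)
    (hl : ∀ x ∈ Ioo (-1 : ℝ) 1, Tendsto (fun i => F i x) l (𝓝 (f x))) :
    (∃ C, ∀ᶠ i in l, ∀ x ∈ Ico (-1 : ℝ) 1, |centeredT d (F i) x| ≤ C * majorant d x) ∧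
      ∀ x ∈ Ico (-1 : ℝ) 1, Tendsto (fun i => centeredT d (F i) x) l (𝓝 (centeredT d f x)) := by
  obtain ⟨C1, hC1⟩ := hb 0 one_pos
  obtain ⟨C2, hC2⟩ := hm
  obtain ⟨A, hA0, hA⟩ := exists_abs_opT_le hd
  obtain ⟨A', hA0', hA'⟩ := exists_abs_centeredT_le hd
  have hbd : ∀ᶠ i in l, ∀ x ∈ Ico (-1 : ℝ) 1,
      |opT d (F i) x| ≤ max C1 C2 * A * majorant d x := by
    filter_upwards [hC1, hC2] with i h1 h2
    exact hA (F i) _ (fun z hz => (h1 z hz).trans (le_max_left _ _))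
      fun y hy => (h2 y hy).trans (le_max_right _ _)
  refine ⟨⟨max C1 C2 * A * A', ?_⟩, fun x hx => ?_⟩
  · filter_upwards [hbd] with i hi
    exact hA' (F i) _ hi
  · refine (tendsto_opT hd hF hb hl hx).sub (Tendsto.div_const ?_ _)
    have h1 := tendsto_bracket_gegW hd (C := max C1 C2 * A) (F := fun i => opT d (F i))
      (f := opT d f) (l := l)
      (by filter_upwards [hF] with i hi using (hi.continuousOn_opT hd).mono Ioo_subset_Ico_self)
      (by filter_upwards [hbd] with i hi x hx using hi x ⟨hx.1.le, hx.2⟩)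
      (fun x hx => tendsto_opT hd hF hb hl ⟨hx.1.le, hx.2⟩) 0
    simpa only [gegW_zero_eq, bracket_comm d _ e0] using h1

/-- On the Abel means one step of the recurrence divides the `n`-th coefficient by
`n (n + d - 2)`. -/
lemma centeredT_abelSum {d : ℕ} (hd : 2 ≤ d) (m : ℕ) {r : ℝ} (hr : |r| < 1) {x : ℝ}
    (hx : x ∈ Ico (-1 : ℝ) 1) : centeredT d (abelSum d m r) x = abelSum d (m + 1) r x := by
  have hs := summable_coeff_mul_pow hd m hr
  have hs' := summable_coeff_mul_pow hd (m + 1) hr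
  set p : ℕ → Polynomial ℝ := fun N => ∑ n ∈ Finset.range N,
    Polynomial.C (coeff d (m + 1) n * r ^ n) * gegPoly d n with hp
  have hpe : ∀ N x, (p N).eval x
      = ∑ n ∈ Finset.range N, coeff d (m + 1) n * r ^ n * gegW d n x := by
    intro N x
    simp only [hp, Polynomial.eval_finsetSum, Polynomial.eval_mul, Polynomial.eval_C,
      gegW_eq_eval]
  have hLp : ∀ N x, (gegL d (p N)).eval x
      = ∑ n ∈ Finset.range N, coeff d m n * r ^ n * gegW d n x := by
    intro N x
    simp only [hp, gegL_sum, gegL_C_mul, Polynomial.eval_finsetSum, Polynomial.eval_mul,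
      Polynomial.eval_C, gegL_gegPoly_eval hd]
    refine Finset.sum_congr rfl fun n _ => ?_
    rw [← coeff_succ_mul_eig hd m n]
    ring
  have hopT : ∀ x ∈ Ico (-1 : ℝ) 1,
      opT d (abelSum d m r) x = abelSum d (m + 1) r x - abelSum d (m + 1) r (-1) := by
    intro x hx
    have h1 := tendsto_opT hd (l := atTop) (F := fun N x => (gegL d (p N)).eval x)
      (f := abelSum d m r)
      (Eventually.of_forall fun N =>
        admissible_of_continuousOn hd (Polynomial.continuous _).continuousOn)
      (fun y hy => ⟨∑' n, |coeff d m n * r ^ n|, Eventually.of_forall fun N z hz => by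
        rw [hLp]
        refine (Finset.abs_sum_le_sum_abs _ _).trans ?_
        refine (Finset.sum_le_sum fun n _ =>
          abs_mul_gegW_le hd _ n ⟨hz.1.le, (hz.2.trans hy).le⟩).trans ?_
        exact hs.sum_le_tsum _ fun _ _ => abs_nonneg _⟩)
      (fun y hy => by
        simp only [hLp]
        exact (summable_mul_gegW hd hs ⟨hy.1.le, hy.2.le⟩).hasSum.tendsto_sum_nat) hx
    have h2 : Tendsto (fun N => opT d (fun x => (gegL d (p N)).eval x) x) atTop
        (𝓝 (abelSum d (m + 1) r x - abelSum d (m + 1) r (-1))) := by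
      simp only [fun N => opT_gegL hd (p N) (x := x) ⟨hx.1, hx.2.le⟩, hpe]
      exact (summable_mul_gegW hd hs' ⟨hx.1, hx.2.le⟩).hasSum.tendsto_sum_nat.sub
        (summable_mul_gegW hd hs' ⟨le_rfl, by norm_num⟩).hasSum.tendsto_sum_nat
    exact tendsto_nhds_unique h1 h2
  have hB := bracket_e0_e0_pos hd
  have hmean : bracket d e0 (opT d (abelSum d m r))
      = -(abelSum d (m + 1) r (-1) * bracket d e0 e0) := by
    rw [bracket_congr fun x hx => hopT x ⟨hx.1.le, hx.2⟩,
      bracket_e0_sub_const hd _ (admissible_of_continuousOn hd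
        (continuousOn_abelSum hd (m + 1) hr)).integrable, bracket_e0_abelSum hd _ hr, zero_sub]
  rw [centeredT, hopT x hx, hmean]
  field_simp
  ring

/-! ### Convergence of the Abel means -/

lemma eventually_abs_lt_one : ∀ᶠ r in 𝓝[<] (1 : ℝ), |r| < 1 := by
  filter_upwards [Ioo_mem_nhdsLT (show (-1 : ℝ) < 1 by norm_num)] with r hr
  exact abs_lt.2 hr

lemma abs_abelSum_zero_le {d : ℕ} (hd : 2 ≤ d) {r : ℝ} (hr : r ∈ Ioo (1 / 2 : ℝ) 1) {x z : ℝ}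
    (hx : x < 1) (hz : z ∈ Ioo (-1 : ℝ) x) :
    |abelSum d 0 r z| ≤ (1 - x) ^ (-((d : ℝ) / 2)) + 1 := by
  have hr1 : |r| < 1 := abs_lt.2 ⟨by linarith [hr.1], hr.2⟩
  have hz1 : z ∈ Icc (-1 : ℝ) 1 := ⟨hz.1.le, (hz.2.trans hx).le⟩
  rw [abelSum_zero hd hr1 hz1]
  have h1 := poisson_nonneg (d := d) hr1 hz1
  have h2 := poisson_le (d := d) hr (hz.2.trans hx)
  have h3 : (1 - z) ^ (-((d : ℝ) / 2)) ≤ (1 - x) ^ (-((d : ℝ) / 2)) := by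
    apply Real.rpow_le_rpow_of_nonpos (by linarith) (by linarith [hz.2])
    have : (0 : ℝ) ≤ d := by positivity
    linarith
  have h4 : 0 ≤ (1 - z) ^ (-((d : ℝ) / 2)) :=
    Real.rpow_nonneg (by linarith [hz.2]) _
  have h5 : (1 - r ^ 2) * (1 - z) ^ (-((d : ℝ) / 2)) ≤ 1 * (1 - z) ^ (-((d : ℝ) / 2)) :=
    mul_le_mul_of_nonneg_right (by nlinarith [hr.1]) h4
  rw [abs_le]
  constructor <;> linarith

/-- The Abel means of `∑_{n ≥ 1} N_{d,n} W_n^λ` have bounded weighted `L¹` norm, because the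
Poisson kernel is nonnegative with constant mass. -/
lemma abs_primitive_abelSum_zero_le {d : ℕ} (hd : 2 ≤ d) {r : ℝ} (hr : |r| < 1) {y : ℝ}
    (hy : y ∈ Icc (-1 : ℝ) 1) :
    |∫ z in (-1 : ℝ)..y, weight d z * abelSum d 0 r z| ≤ 2 * bracket d e0 e0 := by
  have hw : ∀ z ∈ Icc (-1 : ℝ) 1, 0 ≤ weight d z := fun z hz =>
    Real.rpow_nonneg (by nlinarith [hz.1, hz.2]) _
  have hi := (admissible_of_continuousOn hd (continuousOn_abelSum hd 0 hr)).integrable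
  have hW := intervalIntegrable_weight hd
  have hi2 : IntervalIntegrable (fun z => weight d z * abelSum d 0 r z + 2 * weight d z)
      volume (-1) 1 := hi.add (hW.const_mul 2)
  have hpos : ∀ z ∈ Icc (-1 : ℝ) 1, 1 ≤ abelSum d 0 r z + 2 := by
    intro z hz
    rw [abelSum_zero hd hr hz]
    have := poisson_nonneg (d := d) hr hz
    linarith
  have h1 : |∫ z in (-1 : ℝ)..y, weight d z * abelSum d 0 r z|
      ≤ ∫ z in (-1 : ℝ)..y, (weight d z * abelSum d 0 r z + 2 * weight d z) := by
    refine abs_integral_le_of_abs_le hy.1 (fun z hz => ?_)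
      (intervalIntegrable_mono hi2 ⟨le_rfl, by norm_num⟩ hy)
    have hz' : z ∈ Icc (-1 : ℝ) 1 := ⟨hz.1.le, hz.2.le.trans hy.2⟩
    have h2 := hpos z hz'
    have h3 : |abelSum d 0 r z| ≤ abelSum d 0 r z + 2 := by
      rw [abs_le]; constructor <;> linarith
    rw [abs_mul, abs_of_nonneg (hw z hz')]
    have := mul_le_mul_of_nonneg_left h3 (hw z hz')
    linarith
  refine h1.trans ?_
  have h2 : ∫ z in (-1 : ℝ)..y, (weight d z * abelSum d 0 r z + 2 * weight d z)
      ≤ ∫ z in (-1 : ℝ)..1, (weight d z * abelSum d 0 r z + 2 * weight d z) := by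
    refine intervalIntegral.integral_mono_interval le_rfl hy.1 hy.2 ?_ hi2
    have h0 : ∀ᵐ z ∂volume.restrict (Ioc (-1 : ℝ) 1), z ∈ Ioc (-1 : ℝ) 1 :=
      ae_restrict_mem measurableSet_Ioc
    filter_upwards [h0] with z hz
    have hz' : z ∈ Icc (-1 : ℝ) 1 := ⟨hz.1.le, hz.2⟩
    have h4 := mul_nonneg (hw z hz') (zero_le_one.trans (hpos z hz'))
    simp only [Pi.zero_apply]
    linarith
  refine h2.trans_eq ?_
  rw [intervalIntegral.integral_add hi (hW.const_mul 2), ← bracket_e0_eq,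
    bracket_e0_abelSum hd 0 hr, intervalIntegral.integral_const_mul, bracket_e0_eq]
  simp [e0]

/-- On `[-1, 1)` the Abel means of the spline series converge to the functions generated by the
recurrence, and they are dominated. -/
lemma tendsto_abelSum {d : ℕ} (hd : 2 ≤ d) (m : ℕ) :
    (∃ C, ∀ᶠ r in 𝓝[<] (1 : ℝ), ∀ x ∈ Ico (-1 : ℝ) 1,
      |abelSum d (m + 1) r x| ≤ C * majorant d x) ∧
    ∀ x ∈ Ico (-1 : ℝ) 1,
      Tendsto (fun r => abelSum d (m + 1) r x) (𝓝[<] 1) (𝓝 (spline d (m + 1) x)) := by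
  have hadm : ∀ k, ∀ᶠ r in 𝓝[<] (1 : ℝ), Admissible d (abelSum d k r) := fun k => by
    filter_upwards [eventually_abs_lt_one] with r hr
    exact admissible_of_continuousOn hd (continuousOn_abelSum hd k hr)
  have hcongr : ∀ k, ((∃ C, ∀ᶠ r in 𝓝[<] (1 : ℝ), ∀ x ∈ Ico (-1 : ℝ) 1,
      |centeredT d (abelSum d k r) x| ≤ C * majorant d x) ∧ ∀ x ∈ Ico (-1 : ℝ) 1,
      Tendsto (fun r => centeredT d (abelSum d k r) x) (𝓝[<] 1)
        (𝓝 (centeredT d (spline d k) x))) →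
      (∃ C, ∀ᶠ r in 𝓝[<] (1 : ℝ), ∀ x ∈ Ico (-1 : ℝ) 1,
        |abelSum d (k + 1) r x| ≤ C * majorant d x) ∧
      ∀ x ∈ Ico (-1 : ℝ) 1,
        Tendsto (fun r => abelSum d (k + 1) r x) (𝓝[<] 1) (𝓝 (spline d (k + 1) x)) := by
    rintro k ⟨⟨C, hC⟩, hl⟩
    refine ⟨⟨C, ?_⟩, fun x hx => ?_⟩
    · filter_upwards [hC, eventually_abs_lt_one] with r hr hr1 x hx
      rw [← centeredT_abelSum hd k hr1 hx]
      exact hr x hx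
    · refine (hl x hx).congr' ?_
      filter_upwards [eventually_abs_lt_one] with r hr1
      exact centeredT_abelSum hd k hr1 hx
  induction m with
  | zero =>
    have hhalf : ∀ᶠ r in 𝓝[<] (1 : ℝ), r ∈ Ioo (1 / 2 : ℝ) 1 := Ioo_mem_nhdsLT (by norm_num)
    refine hcongr 0 (tendsto_centeredT hd (hadm 0) (fun x hx =>
      ⟨(1 - x) ^ (-((d : ℝ) / 2)) + 1, ?_⟩) ⟨2 * bracket d e0 e0, ?_⟩ fun x hx => ?_)
    · filter_upwards [hhalf] with r hr z hz
      exact abs_abelSum_zero_le hd hr hx hz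
    · filter_upwards [eventually_abs_lt_one] with r hr y hy
      exact abs_primitive_abelSum_zero_le hd hr ⟨by linarith [hy.1], hy.2.le⟩
    · have h1 := (tendsto_poisson (d := d) (x := x) ⟨hx.1.le, hx.2⟩).sub_const 1
      rw [zero_sub] at h1
      refine h1.congr' ?_
      filter_upwards [eventually_abs_lt_one] with r hr
      rw [abelSum_zero hd hr ⟨hx.1.le, hx.2.le⟩]
  | succ m ih =>
    obtain ⟨⟨C, hC⟩, hl⟩ := ih
    refine hcongr (m + 1) (tendsto_centeredT hd (hadm (m + 1)) (fun x hx =>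
      ⟨|C| * majorant d x, ?_⟩) ⟨C * ∫ x in (-1 : ℝ)..1, weight d x * majorant d x, ?_⟩
      fun x hx => hl x ⟨hx.1.le, hx.2⟩)
    · filter_upwards [hC] with r hr z hz
      refine (hr z ⟨hz.1.le, hz.2.trans hx⟩).trans ?_
      exact mul_le_mul (le_abs_self C) (majorant_mono hd hz.2.le hx)
        (majorant_nonneg d (hz.2.trans hx).le) (abs_nonneg C)
    · filter_upwards [hC] with r hr y hy
      exact abs_primitive_le_of_le_majorant hd (fun z hz => hr z ⟨hz.1.le, hz.2⟩)
        ⟨by linarith [hy.1], hy.2.le⟩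

/-! ### The functions generated by the recurrence -/

lemma spline_bound {d : ℕ} (hd : 2 ≤ d) (m : ℕ) :
    ContinuousOn (spline d m) (Ico (-1) 1) ∧
      ∃ C, ∀ x ∈ Ico (-1 : ℝ) 1, |spline d m x| ≤ C * majorant d x := by
  induction m with
  | zero =>
    refine ⟨continuousOn_const, 2 ^ lam d, fun x hx => ?_⟩
    simpa [spline] using one_le_mul_majorant hd hx
  | succ m ih =>
    obtain ⟨hc, C, hC⟩ := ih
    have hadm := admissible_of_le_majorant hd (hc.mono Ioo_subset_Ico_self)
      fun x hx => hC x ⟨hx.1.le, hx.2⟩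
    refine ⟨(hadm.continuousOn_opT hd).sub continuousOn_const, ?_⟩
    obtain ⟨A, -, hA⟩ := exists_abs_opT_le hd
    obtain ⟨A', -, hA'⟩ := exists_abs_centeredT_le hd
    obtain ⟨C1, hC1⟩ := hadm.locBdd 0 one_pos
    set C2 := C * ∫ x in (-1 : ℝ)..1, weight d x * majorant d x
    refine ⟨max C1 C2 * A * A', hA' _ _ (hA _ _ (fun z hz => (hC1 z hz).trans (le_max_left _ _))
      fun y hy => le_trans ?_ (le_max_right _ _))⟩
    exact abs_primitive_le_of_le_majorant hd (fun z hz => hC z ⟨hz.1.le, hz.2⟩)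
        ⟨by linarith [hy.1], hy.2.le⟩

lemma continuousOn_spline {d : ℕ} (hd : 2 ≤ d) (m : ℕ) :
    ContinuousOn (spline d m) (Ico (-1) 1) := (spline_bound hd m).1

lemma admissible_spline {d : ℕ} (hd : 2 ≤ d) (m : ℕ) : Admissible d (spline d m) := by
  obtain ⟨hc, C, hC⟩ := spline_bound hd m
  exact admissible_of_le_majorant hd (hc.mono Ioo_subset_Ico_self)
    fun x hx => hC x ⟨hx.1.le, hx.2⟩

lemma bracket_spline_gegW {d : ℕ} (hd : 2 ≤ d) (m n : ℕ) :
    bracket d (spline d (m + 1)) (gegW d n)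
      = coeff d (m + 1) n * bracket d (gegW d n) (gegW d n) := by
  obtain ⟨⟨C, hC⟩, hl⟩ := tendsto_abelSum hd m
  have h1 := tendsto_bracket_gegW hd (l := 𝓝[<] (1 : ℝ)) (C := C) (F := abelSum d (m + 1))
    (f := spline d (m + 1))
    (by
      filter_upwards [eventually_abs_lt_one] with r hr
      exact (continuousOn_abelSum hd (m + 1) hr).mono Ioo_subset_Icc_self)
    (by filter_upwards [hC] with r hr x hx using hr x ⟨hx.1.le, hx.2⟩)
    (fun x hx => hl x ⟨hx.1.le, hx.2⟩) n
  have h2 : Tendsto (fun r : ℝ => coeff d (m + 1) n * r ^ n * bracket d (gegW d n) (gegW d n))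
      (𝓝[<] 1) (𝓝 (coeff d (m + 1) n * 1 ^ n * bracket d (gegW d n) (gegW d n))) := by
    have hc : Continuous fun r : ℝ =>
        coeff d (m + 1) n * r ^ n * bracket d (gegW d n) (gegW d n) := by fun_prop
    exact (hc.tendsto 1).mono_left nhdsWithin_le_nhds
  rw [one_pow, mul_one] at h2
  refine tendsto_nhds_unique h1 (h2.congr' ?_)
  filter_upwards [eventually_abs_lt_one] with r hr
  rw [bracket_comm d (abelSum d (m + 1) r)]
  exact (bracket_gegW_tsum hd (summable_coeff_mul_pow hd (m + 1) hr) n).symm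

/-! ### Monotonicity -/

lemma bracket_e0_spline {d : ℕ} (hd : 2 ≤ d) (m : ℕ) : bracket d e0 (spline d (m + 1)) = 0 := by
  rw [bracket_comm, ← gegW_zero_eq, bracket_spline_gegW hd, coeff_zero_index, zero_mul]

/-- An increasing function of weighted mean zero is negative first and positive afterwards, so
its weighted primitive from `-1` is nonpositive. -/
lemma primitive_nonpos_of_monotoneOn {d : ℕ} {f : ℝ → ℝ} (hf : MonotoneOn f (Ico (-1) 1))
    (hi : IntervalIntegrable (fun z => weight d z * f z) volume (-1) 1)
    (h0 : ∫ z in (-1 : ℝ)..1, weight d z * f z = 0) {y : ℝ} (hy : y ∈ Ioo (-1 : ℝ) 1) :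
    ∫ z in (-1 : ℝ)..y, weight d z * f z ≤ 0 := by
  have hyc : y ∈ Icc (-1 : ℝ) 1 := ⟨hy.1.le, hy.2.le⟩
  have hi1 := intervalIntegrable_mono hi ⟨le_rfl, by norm_num⟩ hyc
  have hi2 := intervalIntegrable_mono hi hyc ⟨by norm_num, le_rfl⟩
  rcases le_total (f y) 0 with h | h
  · have h1 := intervalIntegral.integral_mono_on_of_le_Ioo hy.1.le hi1
      (intervalIntegrable_const (c := (0 : ℝ))) fun z hz =>
        mul_nonpos_of_nonneg_of_nonpos (weight_pos d (x := z) ⟨hz.1, hz.2.trans hy.2⟩).le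
          ((hf ⟨hz.1.le, hz.2.trans hy.2⟩ ⟨hy.1.le, hy.2⟩ hz.2.le).trans h)
    simpa using h1
  · have h1 := intervalIntegral.integral_mono_on_of_le_Ioo hy.2.le
      (intervalIntegrable_const (c := (0 : ℝ))) hi2 fun z hz =>
        mul_nonneg (weight_pos d (x := z) ⟨hy.1.trans hz.1, hz.2⟩).le
          (h.trans (hf ⟨hy.1.le, hy.2⟩ ⟨(hy.1.trans hz.1).le, hz.2⟩ hz.1.le))
    have h2 := intervalIntegral.integral_add_adjacent_intervals hi1 hi2
    simp only [intervalIntegral.integral_zero] at h1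
    linarith

lemma outerIntegrand_nonpos {d : ℕ} {f : ℝ → ℝ} {y : ℝ} (hy : y ∈ Ioo (-1 : ℝ) 1)
    (h : ∫ z in (-1 : ℝ)..y, weight d z * f z ≤ 0) : outerIntegrand d f y ≤ 0 := by
  rw [outerIntegrand_eq_div f hy]
  exact div_nonpos_of_nonpos_of_nonneg h (bigWeight_pos d hy).le

lemma monotoneOn_opT {d : ℕ} (hd : 2 ≤ d) {f : ℝ → ℝ} (hf : Admissible d f)
    (h : ∀ y ∈ Ioo (-1 : ℝ) 1, outerIntegrand d f y ≤ 0) : MonotoneOn (opT d f) (Ico (-1) 1) := by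
  intro x hx y hy hxy
  have hix := hf.intervalIntegrable_outerIntegrand hd hx
  have hiy := hf.intervalIntegrable_outerIntegrand hd hy
  have h1 := intervalIntegral.integral_mono_on_of_le_Ioo hxy (hix.symm.trans hiy)
      (intervalIntegrable_const (c := (0 : ℝ))) fun z hz =>
        h z ⟨hx.1.trans_lt hz.1, hz.2.trans hy.2⟩
  have h2 := intervalIntegral.integral_add_adjacent_intervals hix (hix.symm.trans hiy)
  simp only [intervalIntegral.integral_zero] at h1
  unfold opT
  linarith

lemma outerIntegrand_spline_nonpos {d : ℕ} (hd : 2 ≤ d) (m : ℕ) :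
    ∀ y ∈ Ioo (-1 : ℝ) 1, outerIntegrand d (spline d m) y ≤ 0 := by
  induction m with
  | zero =>
    intro y hy
    refine outerIntegrand_nonpos hy ?_
    simp only [spline, mul_neg, mul_one, intervalIntegral.integral_neg, neg_nonpos]
    refine intervalIntegral.integral_nonneg hy.1.le fun z hz => ?_
    exact Real.rpow_nonneg (by nlinarith [hz.1, hz.2, hy.2]) _
  | succ m ih =>
    intro y hy
    have hmono : MonotoneOn (spline d (m + 1)) (Ico (-1) 1) := fun a ha b hb hab =>
      sub_le_sub_right (monotoneOn_opT hd (admissible_spline hd m) ih ha hb hab) _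
    refine outerIntegrand_nonpos hy (primitive_nonpos_of_monotoneOn hmono
      (admissible_spline hd (m + 1)).integrable ?_ hy)
    rw [← bracket_e0_eq, bracket_e0_spline hd]

lemma monotoneOn_spline {d : ℕ} (hd : 2 ≤ d) (m : ℕ) :
    MonotoneOn (spline d (m + 1)) (Ico (-1) 1) := fun _ ha _ hb hab =>
  sub_le_sub_right (monotoneOn_opT hd (admissible_spline hd m)
    (outerIntegrand_spline_nonpos hd m) ha hb hab) _

/-! ### The case of a finite value at the endpoint -/

lemma spline_le_tsum_coeff {d : ℕ} (hd : 2 ≤ d) {m : ℕ} (hm : d ≤ 2 * (m + 1)) {x : ℝ}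
    (hx : x ∈ Ico (-1 : ℝ) 1) : spline d (m + 1) x ≤ ∑' n, coeff d (m + 1) n := by
  refine le_of_tendsto ((tendsto_abelSum hd m).2 x hx) ?_
  filter_upwards [eventually_abs_lt_one] with r hr
  refine (le_abs_self _).trans ?_
  rw [← Real.norm_eq_abs]
  refine tsum_of_norm_bounded (summable_coeff hd hm).hasSum fun n => ?_
  refine (abs_mul_gegW_le hd _ n ⟨hx.1, hx.2.le⟩).trans ?_
  rw [abs_mul, abs_pow, abs_of_nonneg (coeff_nonneg hd _ n)]
  exact mul_le_of_le_one_right (coeff_nonneg hd _ n) (pow_le_one₀ (abs_nonneg r) hr.le)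

/-- The outer integrand has constant sign and `T_λ` of it is bounded, so it is integrable up to
the endpoint. -/
lemma intervalIntegrable_outerIntegrand_spline {d : ℕ} (hd : 2 ≤ d) {m : ℕ}
    (hm : d ≤ 2 * (m + 1)) :
    IntervalIntegrable (outerIntegrand d (spline d m)) volume (-1) 1 := by
  have hlt : ∀ᶠ b in 𝓝[<] (1 : ℝ), b ∈ Ioo (-1 : ℝ) 1 := Ioo_mem_nhdsLT (by norm_num)
  rw [intervalIntegrable_iff_integrableOn_Ioc_of_le (by norm_num)]
  set b : ℕ → ℝ := fun n => 1 - 1 / ((n : ℝ) + 1) with hb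
  have hb1 : ∀ n, b n ∈ Ico (-1 : ℝ) 1 := by
    intro n
    have h1 : 0 < 1 / ((n : ℝ) + 1) := Nat.one_div_pos_of_nat
    have h2 : 1 / ((n : ℝ) + 1) ≤ 1 := by
      rw [div_le_one (by positivity)]
      linarith [Nat.cast_nonneg (α := ℝ) n]
    exact ⟨by simp only [hb]; linarith, by simp only [hb]; linarith⟩
  have hbt : Tendsto b atTop (𝓝 1) := by
    have := (tendsto_one_div_add_atTop_nhds_zero_nat (𝕜 := ℝ)).const_sub 1
    simpa [hb] using this
  set c := bracket d e0 (opT d (spline d m)) / bracket d e0 e0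
  have hint := fun n => (admissible_spline hd m).intervalIntegrable_outerIntegrand hd (hb1 n)
  refine integrableOn_Ioc_of_intervalIntegral_norm_bounded_right
    (I := (∑' n, coeff d (m + 1) n) + c) (b := b)
    (fun n => (intervalIntegrable_iff_integrableOn_Ioc_of_le (hb1 n).1).1 (hint n)) hbt
    (Eventually.of_forall fun n => ?_)
  have h1 : ∫ x in Ioc (-1) (b n), ‖outerIntegrand d (spline d m) x‖
      = opT d (spline d m) (b n) := by
    rw [← intervalIntegral.integral_of_le (hb1 n).1, opT, ← intervalIntegral.integral_neg]
    refine intervalIntegral.integral_congr_Ioo_of_le (hb1 n).1 fun x hx => ?_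
    exact abs_of_nonpos (outerIntegrand_spline_nonpos hd m x ⟨hx.1, hx.2.trans (hb1 n).2⟩)
  rw [h1]
  have h2 : spline d (m + 1) (b n) = opT d (spline d m) (b n) - c := rfl
  linarith [spline_le_tsum_coeff hd hm (hb1 n)]

lemma continuousOn_spline_dom {d : ℕ} (hd : 2 ≤ d) (m : ℕ) :
    ContinuousOn (spline d (m + 1)) (dom d (m + 1)) := by
  unfold dom
  split_ifs with hm
  · exact (continuousOn_opT_of_intervalIntegrable (by norm_num)
      (intervalIntegrable_outerIntegrand_spline hd hm)).sub continuousOn_const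
  · exact continuousOn_spline hd (m + 1)

lemma isSplineFunction_spline {d : ℕ} (hd : 2 ≤ d) (m : ℕ) :
    IsSplineFunction d (m + 1) (spline d (m + 1)) where
  continuousOn := continuousOn_spline_dom hd m
  integrable := (admissible_spline hd (m + 1)).integrable.congr fun _ _ => mul_comm _ _
  expansion := bracket_spline_gegW hd m

/-! ### Pointwise sums -/

lemma summable_abs_coeff {d : ℕ} (hd : 2 ≤ d) {m : ℕ} (hm : d ≤ 2 * m) :
    Summable fun n => |coeff d m n| :=
  (summable_coeff hd hm).congr fun n => (abs_of_nonneg (coeff_nonneg hd m n)).symm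

/-- Abel's theorem identifies the sum of the series on `[-1, 1)`. -/
lemma spline_eq_of_tendsto_of_lt {d : ℕ} (hd : 2 ≤ d) (m : ℕ) {x s : ℝ} (hx : x ∈ Ico (-1 : ℝ) 1)
    (h : Tendsto (fun N => ∑ n ∈ Finset.range N, term d (m + 1) x n) atTop (𝓝 s)) :
    spline d (m + 1) x = s := by
  refine tendsto_nhds_unique ((tendsto_abelSum hd m).2 x hx) ?_
  refine (Real.tendsto_tsum_powerSeries_nhdsWithin_lt h).congr fun r => tsum_congr fun n => ?_
  unfold term
  ring

lemma tsum_term_eq_spline {d : ℕ} (hd : 2 ≤ d) {m : ℕ} (hm : d ≤ 2 * (m + 1)) :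
    EqOn (fun x => ∑' n, coeff d (m + 1) n * gegW d n x) (spline d (m + 1)) (Icc (-1) 1) := by
  have hs := summable_abs_coeff hd hm
  have hdom : dom d (m + 1) = Icc (-1) 1 := if_pos hm
  have h1 : EqOn (fun x => ∑' n, coeff d (m + 1) n * gegW d n x) (spline d (m + 1))
      (Ioo (-1) 1) := fun x hx => (spline_eq_of_tendsto_of_lt hd m ⟨hx.1.le, hx.2⟩
        (summable_mul_gegW hd hs ⟨hx.1.le, hx.2.le⟩).hasSum.tendsto_sum_nat).symm
  exact h1.of_subset_closure (continuousOn_tsum_mul_gegW hd hs)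
    (hdom ▸ continuousOn_spline_dom hd m) Ioo_subset_Icc_self
    (by rw [closure_Ioo (by norm_num)])

/-- The series can only converge at points of the domain: at `x = 1` its partial sums are those of
the coefficients. -/
lemma spline_eq_of_tendsto {d : ℕ} (hd : 2 ≤ d) (m : ℕ) {x s : ℝ} (hx : x ∈ Icc (-1 : ℝ) 1)
    (h : Tendsto (fun N => ∑ n ∈ Finset.range N, term d (m + 1) x n) atTop (𝓝 s)) :
    x ∈ dom d (m + 1) ∧ spline d (m + 1) x = s := by
  rcases le_or_gt d (2 * (m + 1)) with hm | hm
  · refine ⟨by rwa [dom, if_pos hm], ?_⟩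
    rw [← tsum_term_eq_spline hd hm hx]
    exact tendsto_nhds_unique
      (summable_mul_gegW hd (summable_abs_coeff hd hm) hx).hasSum.tendsto_sum_nat h
  · have hx1 : x < 1 := by
      refine lt_of_le_of_ne hx.2 ?_
      rintro rfl
      simp only [term, gegW_one, mul_one] at h
      exact not_tendsto_nhds_of_tendsto_atTop (tendsto_sum_coeff_atTop hd hm) s h
    exact ⟨Ico_subset_dom d _ ⟨hx.1, hx1⟩, spline_eq_of_tendsto_of_lt hd m ⟨hx.1, hx1⟩ h⟩

/-! ### Averaging against the Poisson kernel -/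

lemma exists_abs_gegW_sub_one_le (d n : ℕ) :
    ∃ L, ∀ x ∈ Icc (-1 : ℝ) 1, |gegW d n x - 1| ≤ L * (1 - x) := by
  obtain ⟨q, hq⟩ := Polynomial.dvd_iff_isRoot.2
    (show (gegPoly d n - Polynomial.C 1).IsRoot 1 by simp [gegPoly_eval_one])
  obtain ⟨L, hL⟩ := isCompact_Icc.exists_bound_of_continuousOn (s := Icc (-1 : ℝ) 1)
    (f := fun x => q.eval x) q.continuous.continuousOn
  refine ⟨L, fun x hx => ?_⟩
  have h1 := congrArg (Polynomial.eval x) hq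
  simp only [Polynomial.eval_sub, Polynomial.eval_mul, Polynomial.eval_C, Polynomial.eval_X] at h1
  have h2 : 0 ≤ 1 - x := by linarith [hx.2]
  rw [gegW_eq_eval, h1, abs_mul, abs_sub_comm, abs_of_nonneg h2, mul_comm]
  exact mul_le_mul_of_nonneg_right (hL x hx) h2

lemma abelSum_zero_add_one_nonneg {d : ℕ} (hd : 2 ≤ d) {r x : ℝ} (hr : |r| < 1)
    (hx : x ∈ Icc (-1 : ℝ) 1) : 0 ≤ abelSum d 0 r x + 1 := by
  rw [abelSum_zero hd hr hx, sub_add_cancel]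
  exact poisson_nonneg hr hx

lemma integral_gegW_sub_one_mul {d : ℕ} (hd : 2 ≤ d) {n : ℕ} (hn : n ≠ 0) {r : ℝ} (hr : |r| < 1) :
    ∫ x in (-1 : ℝ)..1, (gegW d n x - 1) * (abelSum d 0 r x + 1) * weight d x
      = harmDim d n * r ^ n * bracket d (gegW d n) (gegW d n) - bracket d e0 e0 := by
  have hA := continuousOn_abelSum hd 0 hr
  have hW : ContinuousOn (gegW d n) (Icc (-1) 1) := (continuous_gegW d n).continuousOn
  have hc : ContinuousOn e0 (Icc (-1) 1) := continuousOn_const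
  have i1 := intervalIntegrable_continuousOn_mul_weight hd (hW.fun_mul hA)
  have i2 := intervalIntegrable_continuousOn_mul_weight hd (hc.fun_mul hW)
  have i3 := intervalIntegrable_continuousOn_mul_weight hd (hc.fun_mul hA)
  have i4 := intervalIntegrable_continuousOn_mul_weight hd (hc.fun_mul hc)
  have h1 : ∀ x, (gegW d n x - 1) * (abelSum d 0 r x + 1) * weight d x
      = gegW d n x * abelSum d 0 r x * weight d x + e0 x * gegW d n x * weight d x
        - (e0 x * abelSum d 0 r x * weight d x + e0 x * e0 x * weight d x) := by
    intro x; simp only [e0]; ring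
  simp only [h1]
  rw [intervalIntegral.integral_sub (i1.add i2) (i3.add i4), intervalIntegral.integral_add i1 i2,
    intervalIntegral.integral_add i3 i4]
  change bracket d (gegW d n) (fun x => ∑' k, coeff d 0 k * r ^ k * gegW d k x)
    + bracket d e0 (gegW d n) - (bracket d e0 (abelSum d 0 r) + bracket d e0 e0) = _
  rw [bracket_gegW_tsum hd (summable_coeff_mul_pow hd 0 hr), bracket_e0_gegW hd hn,
    bracket_e0_abelSum hd 0 hr, coeff_of_ne_zero _ _ hn]
  simp

lemma harmDim_one (d : ℕ) : harmDim d 1 = d := by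
  simp [harmDim]

/-- The norms of the Gegenbauer polynomials: the `n`-th moment of the Poisson kernel tends to the
value `1` of `W_n^λ` at the point where the kernel concentrates. The concentration is measured by
the moment of `1 - x`, which is explicit since `W_1^λ(x) = x`. -/
lemma harmDim_mul_bracket_gegW {d : ℕ} (hd : 2 ≤ d) {n : ℕ} (hn : n ≠ 0) :
    harmDim d n * bracket d (gegW d n) (gegW d n) = bracket d e0 e0 := by
  obtain ⟨L, hL⟩ := exists_abs_gegW_sub_one_le d n
  set B := bracket d e0 e0
  set Q := harmDim d n * bracket d (gegW d n) (gegW d n) with hQ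
  have key : ∀ r : ℝ, |r| < 1 → |Q * r ^ n - B| ≤ L * (B * (1 - r)) := by
    intro r hr
    have h1 := integral_gegW_sub_one_mul hd hn hr
    have h2 := integral_gegW_sub_one_mul hd one_ne_zero hr
    rw [harmDim_one, pow_one, mul_right_comm, bracket_gegW_one hd] at h2
    have hA := continuousOn_abelSum hd 0 hr
    have h3 := abs_integral_le_of_abs_le (a := -1) (b := 1) (by norm_num)
      (f := fun x => (gegW d n x - 1) * (abelSum d 0 r x + 1) * weight d x)
      (g := fun x => -L * ((gegW d 1 x - 1) * (abelSum d 0 r x + 1) * weight d x))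
      (fun x hx => by
        have hx' : x ∈ Icc (-1 : ℝ) 1 := ⟨hx.1.le, hx.2.le⟩
        have h4 := abelSum_zero_add_one_nonneg hd hr hx'
        have h5 := (weight_pos d hx).le
        rw [abs_mul, abs_mul, abs_of_nonneg h4, abs_of_nonneg h5, gegW_index_one hd]
        have h6 := mul_le_mul_of_nonneg_right (hL x hx') (mul_nonneg h4 h5)
        linarith)
      ((intervalIntegrable_continuousOn_mul_weight hd
        ((((continuous_gegW d 1).continuousOn).sub continuousOn_const).mul
          (hA.add continuousOn_const))).const_mul _)
    rw [intervalIntegral.integral_const_mul, h1, h2] at h3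
    convert h3 using 1
    · rw [hQ, mul_right_comm]
    · ring
  have hlim : Tendsto (fun r : ℝ => |Q * r ^ n - B|) (𝓝[<] 1) (𝓝 |Q * 1 ^ n - B|) :=
    ((by fun_prop : Continuous fun r : ℝ => |Q * r ^ n - B|).tendsto 1).mono_left
      nhdsWithin_le_nhds
  have hlim2 : Tendsto (fun r : ℝ => L * (B * (1 - r))) (𝓝[<] 1) (𝓝 (L * (B * (1 - 1)))) :=
    ((by fun_prop : Continuous fun r : ℝ => L * (B * (1 - r))).tendsto 1).mono_left
      nhdsWithin_le_nhds
  have h := le_of_tendsto_of_tendsto hlim hlim2 (by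
    filter_upwards [eventually_abs_lt_one] with r hr using key r hr)
  rw [one_pow, mul_one, sub_self, mul_zero, mul_zero] at h
  exact sub_eq_zero.1 (abs_nonpos_iff.1 h)

/-- An upper bound of the spline function bounds the partial sums of its coefficients, since the
Abel means of the coefficients are averages of the function against the Poisson kernel. -/
lemma sum_coeff_le_of_spline_le {d : ℕ} (hd : 2 ≤ d) (m : ℕ) {M : ℝ}
    (hM : ∀ x ∈ Ioo (-1 : ℝ) 1, spline d (m + 1) x ≤ M) (N : ℕ) :
    ∑ n ∈ Finset.range N, coeff d (m + 1) n ≤ M := by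
  have hB := bracket_e0_e0_pos hd
  set B := bracket d e0 e0
  have key : ∀ r ∈ Ioo (0 : ℝ) 1, ∑ n ∈ Finset.range N, coeff d (m + 1) n * r ^ n ≤ M := by
    intro r hr
    have hr1 : |r| < 1 := abs_lt.2 ⟨by linarith [hr.1], hr.2⟩
    have hA := continuousOn_abelSum hd 0 hr1
    have hS := (isSplineFunction_spline hd m).integrable
    have h1 := hasSum_bracket hd (summable_coeff_mul_pow hd 0 hr1) hS
    have h2 : ∀ n, coeff d 0 n * r ^ n * bracket d (spline d (m + 1)) (gegW d n)
        = coeff d (m + 1) n * r ^ n * B := by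
      intro n
      rcases eq_or_ne n 0 with rfl | hn
      · simp [coeff_zero_index]
      · rw [bracket_spline_gegW hd, coeff_of_ne_zero d 0 hn, pow_zero, div_one]
        linear_combination coeff d (m + 1) n * r ^ n * harmDim_mul_bracket_gegW hd hn
    simp only [h2] at h1
    have h3 := h1.summable.sum_le_tsum (Finset.range N) fun n _ =>
      mul_nonneg (mul_nonneg (coeff_nonneg hd _ n) (pow_nonneg hr.1.le n)) hB.le
    rw [h1.tsum_eq, ← Finset.sum_mul] at h3
    refine le_of_mul_le_mul_right (h3.trans ?_) hB
    change bracket d (spline d (m + 1)) (abelSum d 0 r) ≤ M * B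
    have i1 : IntervalIntegrable (fun x => spline d (m + 1) x * abelSum d 0 r x * weight d x)
        volume (-1) 1 :=
      (hS.mul_continuousOn (g := abelSum d 0 r) (by rwa [uIcc_of_le (by norm_num)])).congr
        fun x _ => by ring
    have i2 : IntervalIntegrable (fun x => e0 x * spline d (m + 1) x * weight d x)
        volume (-1) 1 := hS.congr fun x _ => by simp [e0]
    have hc : ContinuousOn e0 (Icc (-1) 1) := continuousOn_const
    have i3 := intervalIntegrable_continuousOn_mul_weight hd (hc.fun_mul hA)
    have i4 := intervalIntegrable_continuousOn_mul_weight hd (hc.fun_mul hc)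
    have h4 := intervalIntegral.integral_mono_on_of_le_Ioo (a := (-1 : ℝ)) (b := 1) (by norm_num)
      (i1.add i2) ((i3.add i4).const_mul M) fun x hx => by
        have h5 := abelSum_zero_add_one_nonneg hd hr1 ⟨hx.1.le, hx.2.le⟩
        have h6 := mul_le_mul_of_nonneg_right (hM x hx) (mul_nonneg h5 (weight_pos d hx).le)
        simp only [e0]
        linarith
    rw [intervalIntegral.integral_add i1 i2, intervalIntegral.integral_const_mul,
      intervalIntegral.integral_add i3 i4] at h4
    change bracket d (spline d (m + 1)) (abelSum d 0 r) + bracket d e0 (spline d (m + 1))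
      ≤ M * (bracket d e0 (abelSum d 0 r) + B) at h4
    rwa [bracket_e0_spline hd, bracket_e0_abelSum hd 0 hr1, add_zero, zero_add] at h4
  have hlim : Tendsto (fun r : ℝ => ∑ n ∈ Finset.range N, coeff d (m + 1) n * r ^ n) (𝓝[<] 1)
      (𝓝 (∑ n ∈ Finset.range N, coeff d (m + 1) n * 1 ^ n)) :=
    ((by fun_prop : Continuous fun r : ℝ =>
      ∑ n ∈ Finset.range N, coeff d (m + 1) n * r ^ n).tendsto 1).mono_left nhdsWithin_le_nhds
  simp only [one_pow, mul_one] at hlim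
  refine le_of_tendsto hlim ?_
  filter_upwards [Ioo_mem_nhdsLT (zero_lt_one' ℝ)] with r hr using key r hr

/-- A bound near the endpoint would, by monotonicity, be a bound everywhere, and then the series of
the coefficients would converge. -/
lemma tendsto_spline_atTop {d : ℕ} (hd : 2 ≤ d) {m : ℕ} (hm : 2 * (m + 1) < d) :
    Tendsto (spline d (m + 1)) (𝓝[<] 1) atTop := by
  refine tendsto_atTop.2 fun M => ?_
  obtain ⟨x, hx, hMx⟩ : ∃ x ∈ Ioo (-1 : ℝ) 1, M < spline d (m + 1) x := by
    by_contra! h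
    obtain ⟨N, hN⟩ := ((tendsto_sum_coeff_atTop hd hm).eventually_gt_atTop M).exists
    exact absurd (sum_coeff_le_of_spline_le hd m h N) (not_le.2 hN)
  filter_upwards [Ioo_mem_nhdsLT hx.2] with y hy
  exact hMx.le.trans (monotoneOn_spline hd m ⟨hx.1.le, hx.2⟩ ⟨(hx.1.trans hy.1).le, hy.2⟩ hy.1.le)

lemma tendsto_opT_spline_atTop {d : ℕ} (hd : 2 ≤ d) {m : ℕ} (hm : 2 * (m + 1) < d) :
    Tendsto (opT d (spline d m)) (𝓝[<] 1) atTop := by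
  have h := tendsto_atTop_add_const_right (𝓝[<] (1 : ℝ))
    (bracket d e0 (opT d (spline d m)) / bracket d e0 e0) (tendsto_spline_atTop hd hm)
  exact h.congr fun x => sub_add_cancel _ _

/-! ### The recurrence -/

lemma intervalIntegrable_of_eqOn_Ioo {a b : ℝ} (hab : a ≤ b) {f g : ℝ → ℝ}
    (hf : IntervalIntegrable f volume a b) (h : EqOn f g (Ioo a b)) :
    IntervalIntegrable g volume a b := by
  rw [intervalIntegrable_iff_integrableOn_Ioo_of_le hab] at hf ⊢
  exact hf.congr_fun h measurableSet_Ioo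

lemma outerIntegrand_congr {d : ℕ} {f g : ℝ → ℝ} (h : EqOn f g (Ioo (-1) 1)) {y : ℝ}
    (hy : y ∈ Icc (-1 : ℝ) 1) : outerIntegrand d f y = outerIntegrand d g y := by
  unfold outerIntegrand
  rw [intervalIntegral.integral_congr_Ioo_of_le hy.1]
  intro z hz
  simp only [h ⟨hz.1, hz.2.trans_le hy.2⟩]

lemma opT_congr {d : ℕ} {f g : ℝ → ℝ} (h : EqOn f g (Ioo (-1) 1)) {x : ℝ}
    (hx : x ∈ Icc (-1 : ℝ) 1) : opT d f x = opT d g x := by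
  unfold opT
  rw [intervalIntegral.integral_congr_Ioo_of_le hx.1]
  exact fun y hy => outerIntegrand_congr h ⟨hy.1.le, hy.2.le.trans hx.2⟩

lemma centeredT_congr {d : ℕ} {f g : ℝ → ℝ} (h : EqOn f g (Ioo (-1) 1)) {x : ℝ}
    (hx : x ∈ Icc (-1 : ℝ) 1) : centeredT d f x = centeredT d g x := by
  unfold centeredT
  rw [opT_congr h hx, bracket_congr fun y hy => opT_congr h ⟨hy.1.le, hy.2.le⟩]

lemma outerIntegrand_neg (d : ℕ) (f : ℝ → ℝ) :
    outerIntegrand d (fun x => -f x) = fun y => -outerIntegrand d f y := by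
  funext y
  simp only [outerIntegrand, mul_neg, intervalIntegral.integral_neg]

lemma opT_neg (d : ℕ) (f : ℝ → ℝ) : opT d (fun x => -f x) = fun x => -opT d f x := by
  funext x
  simp only [opT, outerIntegrand_neg, intervalIntegral.integral_neg]

lemma opT_spline_zero (d : ℕ) : opT d (spline d 0) = fun x => -opT d e0 x := opT_neg d e0

lemma spline_one (d : ℕ) (x : ℝ) :
    spline d 1 x = bracket d e0 (opT d e0) / bracket d e0 e0 - opT d e0 x := by
  have h : bracket d e0 (fun x => -opT d e0 x) = -bracket d e0 (opT d e0) := by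
    simp only [bracket, mul_neg, neg_mul, intervalIntegral.integral_neg]
  simp only [spline, centeredT]
  rw [show (fun _ => -1 : ℝ → ℝ) = spline d 0 from rfl, opT_spline_zero, h]
  ring

lemma IsSplineFunction.congr {d m : ℕ} {f g : ℝ → ℝ} (hf : IsSplineFunction d m f)
    (h : EqOn g f (dom d m)) : IsSplineFunction d m g where
  continuousOn := hf.continuousOn.congr h
  integrable := intervalIntegrable_of_eqOn_Ioo (by norm_num) hf.integrable fun x hx => by
    simp only [h (Ioo_subset_dom d m hx)]
  expansion n := by
    rw [bracket_comm, bracket_congr (h.mono (Ioo_subset_dom d m)), bracket_comm, hf.expansion]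

lemma forall_isSplineFunction_iff {d : ℕ} (hd : 2 ≤ d) (k : ℕ → ℝ → ℝ) :
    (∀ m, 1 ≤ m → IsSplineFunction d m (k m)) ↔
      ∀ m, EqOn (k (m + 1)) (spline d (m + 1)) (dom d (m + 1)) := by
  refine ⟨fun h m => (h (m + 1) (by omega)).unique hd (isSplineFunction_spline hd m),
    fun h m hm => ?_⟩
  obtain ⟨m, rfl⟩ : ∃ n, m = n + 1 := ⟨m - 1, by omega⟩
  exact (isSplineFunction_spline hd m).congr (h m)

lemma forall_eqOn_spline_iff (d : ℕ) (k : ℕ → ℝ → ℝ) :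
    (∀ m, EqOn (k (m + 1)) (spline d (m + 1)) (dom d (m + 1))) ↔
      (∀ x ∈ dom d 1, k 1 x = bracket d e0 (opT d e0) / bracket d e0 e0 - opT d e0 x) ∧
      ∀ m, 1 < m → ∀ x ∈ dom d m, k m x = centeredT d (k (m - 1)) x := by
  constructor
  · refine fun h => ⟨fun x hx => (h 0 hx).trans (spline_one d x), fun m hm x hx => ?_⟩
    obtain ⟨m, rfl⟩ : ∃ n, m = n + 2 := ⟨m - 2, by omega⟩
    exact (h (m + 1) hx).trans
      (centeredT_congr ((h m).mono (Ioo_subset_dom d _)) (dom_subset_Icc d _ hx)).symm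
  · rintro ⟨h1, h2⟩ m
    induction m with
    | zero => exact fun x hx => (h1 x hx).trans (spline_one d x).symm
    | succ m ih =>
      exact fun x hx => (h2 (m + 2) (by omega) x hx).trans
        (centeredT_congr (ih.mono (Ioo_subset_dom d _)) (dom_subset_Icc d _ hx))

/-! ### Existence of the integrals -/

lemma stepDefined_of_eqOn_spline {d : ℕ} (hd : 2 ≤ d) (m : ℕ) {f : ℝ → ℝ}
    (h : EqOn f (spline d m) (Ioo (-1) 1)) : StepDefined d (m + 1) f := by
  have hS := admissible_spline hd m
  refine ⟨intervalIntegrable_of_eqOn_Ioo (by norm_num) hS.integrable fun x hx => by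
    simp only [h hx], fun x hx => ?_, ?_⟩
  · have hx' := dom_subset_Icc d _ hx
    have h1 : IntervalIntegrable (outerIntegrand d (spline d m)) volume (-1) x := by
      rcases hx'.2.eq_or_lt with rfl | hx1
      · refine intervalIntegrable_outerIntegrand_spline hd ?_
        by_contra hm
        rw [dom, if_neg hm] at hx
        exact lt_irrefl _ hx.2
      · exact hS.intervalIntegrable_outerIntegrand hd ⟨hx'.1, hx1⟩
    exact intervalIntegrable_of_eqOn_Ioo hx'.1 h1 fun y hy =>
      (outerIntegrand_congr h ⟨hy.1.le, hy.2.le.trans hx'.2⟩).symm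
  · have h1 := (isSplineFunction_spline hd m).integrable.add
      ((intervalIntegrable_weight hd).const_mul
        (bracket d e0 (opT d (spline d m)) / bracket d e0 e0))
    refine intervalIntegrable_of_eqOn_Ioo (by norm_num) h1 fun x hx => ?_
    simp only [e0, spline, centeredT, opT_congr h ⟨hx.1.le, hx.2.le⟩]
    ring

lemma StepDefined.neg {d m : ℕ} {f : ℝ → ℝ} (h : StepDefined d m f) :
    StepDefined d m fun x => -f x := by
  obtain ⟨h1, h2, h3⟩ := h
  refine ⟨h1.neg.congr fun x _ => by simp, fun x hx => ?_, ?_⟩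
  · rw [outerIntegrand_neg]
    exact (h2 x hx).neg
  · rw [opT_neg]
    exact h3.neg.congr fun x _ => by simp

lemma stepDefined_e0 {d : ℕ} (hd : 2 ≤ d) : StepDefined d 1 e0 := by
  have h := (stepDefined_of_eqOn_spline hd 0 (eqOn_refl _ _)).neg
  rwa [show (fun x => -spline d 0 x) = e0 from funext fun _ => neg_neg 1] at h

end Thinplate

theorem theorem5p1 (d : ℕ) (hd : 2 ≤ d) :
    -- the thinplate spline functions exist and are determined by their series
    (∀ m : ℕ, 1 ≤ m → ∃ k : ℝ → ℝ, Thinplate.IsSplineFunction d m k ∧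
      ∀ g : ℝ → ℝ, Thinplate.IsSplineFunction d m g → EqOn g k (Thinplate.dom d m)) ∧
    -- they are exactly the functions generated by the recurrence
    (∀ k : ℕ → ℝ → ℝ,
      (∀ m : ℕ, 1 ≤ m → Thinplate.IsSplineFunction d m (k m)) ↔
        (∀ x ∈ Thinplate.dom d 1,
          k 1 x = Thinplate.bracket d Thinplate.e0 (Thinplate.opT d Thinplate.e0) /
              Thinplate.bracket d Thinplate.e0 Thinplate.e0
            - Thinplate.opT d Thinplate.e0 x) ∧
        (∀ m : ℕ, 1 < m → ∀ x ∈ Thinplate.dom d m,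
          k m x = Thinplate.opT d (k (m - 1)) x
            - Thinplate.bracket d Thinplate.e0 (Thinplate.opT d (k (m - 1))) /
              Thinplate.bracket d Thinplate.e0 Thinplate.e0)) ∧
    -- everything in the recurrence is well defined
    0 < Thinplate.bracket d Thinplate.e0 Thinplate.e0 ∧
    Thinplate.StepDefined d 1 Thinplate.e0 ∧
    (∀ k : ℕ → ℝ → ℝ, (∀ m : ℕ, 1 ≤ m → Thinplate.IsSplineFunction d m (k m)) →
      (∀ m : ℕ, 1 < m → Thinplate.StepDefined d m (k (m - 1))) ∧
      -- wherever the series converges, its sum is the value of the function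
      (∀ m : ℕ, 1 ≤ m → ∀ x ∈ Icc (-1 : ℝ) 1, ∀ s : ℝ,
        Tendsto (fun N : ℕ => ∑ n ∈ Finset.range N, Thinplate.term d m x n) atTop (𝓝 s) →
          k m x = s) ∧
      -- for `2m ≥ d` it converges on all of `[-1, 1]`
      (∀ m : ℕ, d ≤ 2 * m → ∀ x ∈ Icc (-1 : ℝ) 1, Summable (Thinplate.term d m x)) ∧
      -- for `2m < d` both sides of the recurrence are `+∞` at `x = 1`
      (∀ m : ℕ, 1 ≤ m → 2 * m < d →
        Tendsto (fun N : ℕ => ∑ n ∈ Finset.range N, Thinplate.term d m 1 n) atTop atTop ∧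
        Tendsto (k m) (𝓝[<] 1) atTop ∧
        (m = 1 → Tendsto (fun x => -Thinplate.opT d Thinplate.e0 x) (𝓝[<] 1) atTop) ∧
        (1 < m → Tendsto (Thinplate.opT d (k (m - 1))) (𝓝[<] 1) atTop))) := by
  open Thinplate in
  refine ⟨fun m hm => ?_, fun k => ?_, bracket_e0_e0_pos hd, stepDefined_e0 hd, fun k hk => ?_⟩
  · obtain ⟨m, rfl⟩ : ∃ n, m = n + 1 := ⟨m - 1, by omega⟩
    exact ⟨spline d (m + 1), isSplineFunction_spline hd m,
      fun g hg => hg.unique hd (isSplineFunction_spline hd m)⟩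
  · exact (forall_isSplineFunction_iff hd k).trans (forall_eqOn_spline_iff d k)
  rw [forall_isSplineFunction_iff hd] at hk
  have hk' := fun m => (hk m).mono (Ioo_subset_dom d (m + 1))
  have hIoo : ∀ᶠ x in 𝓝[<] (1 : ℝ), x ∈ Ioo (-1 : ℝ) 1 := Ioo_mem_nhdsLT (by norm_num)
  refine ⟨fun m hm => ?_, fun m hm x hx s hs => ?_, fun m hm x hx => ?_, fun m hm hmd => ?_⟩
  · obtain ⟨m, rfl⟩ : ∃ n, m = n + 2 := ⟨m - 2, by omega⟩
    exact stepDefined_of_eqOn_spline hd (m + 1) (hk' m)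
  · obtain ⟨m, rfl⟩ : ∃ n, m = n + 1 := ⟨m - 1, by omega⟩
    obtain ⟨hx1, hx2⟩ := spline_eq_of_tendsto hd m hx hs
    exact (hk m hx1).trans hx2
  · exact summable_mul_gegW hd (summable_abs_coeff hd hm) hx
  · obtain ⟨m, rfl⟩ : ∃ n, m = n + 1 := ⟨m - 1, by omega⟩
    have h1 := tendsto_opT_spline_atTop hd hmd
    refine ⟨?_, (tendsto_spline_atTop hd hmd).congr' ?_, fun h => ?_, fun h => h1.congr' ?_⟩
    · simpa only [term, gegW_one, mul_one] using tendsto_sum_coeff_atTop hd hmd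
    · filter_upwards [hIoo] with x hx using (hk' m hx).symm
    · obtain rfl : m = 0 := by omega
      rwa [opT_spline_zero] at h1
    · obtain ⟨m, rfl⟩ : ∃ n, m = n + 1 := ⟨m - 1, by omega⟩
      filter_upwards [hIoo] with x hx using (opT_congr (hk' m) ⟨hx.1.le, hx.2.le⟩).symm
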